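/- Let $\mathscr H=\mathbb R^{4n}\times\mathbb R^3=\mathbb H^n\times\mathrm{Im}\,\mathbb H$ be the right quaternionic Heisenberg group, with $(x,t)\cdot(y,s)=(x+y,\,t+s+2\,\mathrm{Im}(x\bar y))$, where $x\bar y=\sum_{l=0}^{n-1}x_l\bar y_l$ and $x_l=x_{4l+1}+x_{4l+2}\mathbf i+x_{4l+3}\mathbf j+x_{4l+4}\mathbf k$. Let $\mathscr H_{\mathbb Z}=\mathbb Z^{4n+3}$ be its integer lattice and $\mathscr H/\mathscr H_{\mathbb Z}$ the compact quotient by left translations. Functions on it are the functions on $\mathscr H$ that are invariant under left translation by $\mathscr H_{\mathbb Z}$, and it carries Lebesgue measure on the fundamental domain $[0,1)^{4n+3}$. Let $Y_a$ ($1\le a\le 4n$) be the left invariant vector fields $(Y_af)(p)=\frac{d}{d\tau}f(p\cdot(\tau e_a))|_{\tau=0}$, and put, for $l=0,\dots,n-1$, $$\begin{pmatrix}Z_{2l}^{0'}&Z_{2l}^{1'}\\ Z_{2l+1}^{0'}&Z_{2l+1}^{1'}\end{pmatrix}=\begin{pmatrix}-Y_{4l+3}-\mathbf iY_{4l+4}&-Y_{4l+1}-\mathbf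 iY_{4l+2}\\ Y_{4l+1}-\mathbf iY_{4l+2}&-Y_{4l+3}+\mathbf iY_{4l+4}\end{pmatrix}$$ (here $\mathbf i$ is the imaginary unit of $\mathbb C$). For $0\le j\le k$ let $\mathscr V_j=\odot^{k-j}\mathbb C^2\otimes\wedge^j\mathbb C^{2n}$, realized as the tuples $(f_{A_1\cdots A_jA_1'\cdots A_{k-j}'})$ with $A_i\in\{0,\dots,2n-1\}$ and $A_i'\in\{0',1'\}$ that are antisymmetric in the unprimed and symmetric in the primed indices, with the Hermitian inner product given by summation over all values of all indices. For $k\ge2$ let $$(\mathscr D_0f)_{AA_2'\cdots A_k'}=\sum_{A'=0',1'}Z_A^{A'}f_{A'A_2'\cdots A_k'},\qquad (\mathscr D_1f)_{ABA_3'\cdots A_k'}=\sum_{A'=0',1'}\left(Z_A^{A'}f_{BA'A_3'\cdots A_k'}-Z_B^{A'}f_{AA'A_3'\cdots A_k'}\right).$$ Regard $\mathscr D_j$ ($j=0,1$) as the densely defined operator $L^2(\mathscr H/\mathscr H_{\mathbb Z},\mathscr V_j)\to L^2(\mathscr H/\mathscr H_{\mathbb Z},\mathscr V_{j+1})$ whose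 domain $\mathrm{Dom}(\mathscr D_j)$ consists of all $f\in L^2$ for which $\mathscr D_jf$, taken in the sense of distributions, is in $L^2$. Let $\mathscr D_0^*$ be the Hilbert space adjoint of $\mathscr D_0$. **Theorem.** For all integers $n>3$ and $k\ge2$ there is a constant $c_{n,k}>0$ such that $$\|\mathscr D_0^*f\|^2+\|\mathscr D_1f\|^2\ge c_{n,k}\|f\|^2$$ for every $f\in\mathrm{Dom}(\mathscr D_1)\cap\mathrm{Dom}(\mathscr D_0^*)\subset L^2(\mathscr H/\mathscr H_{\mathbb Z},\mathscr V_1)$ that is orthogonal to the constant vectors, i.e. $\langle f,C\rangle=0$ for every constant $C\in\mathscr V_1$; all norms are $L^2$ norms on $\mathscr H/\mathscr H_{\mathbb Z}$. -/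

import Mathlib

open MeasureTheory
open scoped ContDiff

namespace TangentialCF

/-- The manifold `ℝ⁴ⁿ × ℝ³` underlying the right quaternionic Heisenberg group of quaternionic
dimension `n`. The coordinate `x_{4l+j}` (`l = 0, …, n-1`, `j = 1, …, 4`) of a point `p` is
`p.1 (l, j - 1)`, the coordinate `t_β` (`β = 1, 2, 3`) is `p.2 (β - 1)`. -/
abbrev Heis (n : ℕ) : Type := (Fin n × Fin 4 → ℝ) × (Fin 3 → ℝ)

/-- The three skew-symmetric matrices `B¹, B², B³` with
`Im (x * conj y) = ∑_β ∑_{k,j} B^β_{kj} x_k y_j i_β` for quaternions `x`, `y`. -/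
def B : Fin 3 → Matrix (Fin 4) (Fin 4) ℝ :=
  ![!![0, -1, 0, 0; 1, 0, 0, 0; 0, 0, 0, -1; 0, 0, 1, 0],
    !![0, 0, -1, 0; 0, 0, 0, 1; 1, 0, 0, 0; 0, -1, 0, 0],
    !![0, 0, 0, -1; 0, 0, -1, 0; 0, 1, 0, 0; 1, 0, 0, 0]]

/-- The group law `(x, t) · (y, s) = (x + y, t + s + 2 Im (x * conj y))`. -/
def mul {n : ℕ} (p q : Heis n) : Heis n :=
  (p.1 + q.1, fun β => p.2 β + q.2 β +
    2 * ∑ l : Fin n, ∑ k : Fin 4, ∑ j : Fin 4, B β k j * p.1 (l, k) * q.1 (l, j))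

/-- The point of the lattice `ℤ⁴ⁿ⁺³` with the given integer coordinates. -/
def latticePoint {n : ℕ} (a : Fin n × Fin 4 → ℤ) (m : Fin 3 → ℤ) : Heis n :=
  (fun i => (a i : ℝ), fun β => (m β : ℝ))

/-- A function on the group is periodic if it is invariant under left translation by the lattice;
periodic functions are the functions on the compact quotient manifold. -/
def IsPeriodic {n : ℕ} {α : Type*} (φ : Heis n → α) : Prop :=
  ∀ (a : Fin n × Fin 4 → ℤ) (m : Fin 3 → ℤ) (p : Heis n), φ (mul (latticePoint a m) p) = φ p

/-- The half-open unit cube, a fundamental domain for the lattice. -/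
def fundDomain (n : ℕ) : Set (Heis n) :=
  {p | (∀ i, p.1 i ∈ Set.Ico (0 : ℝ) 1) ∧ ∀ β, p.2 β ∈ Set.Ico (0 : ℝ) 1}

/-- The measure of the compact quotient: Lebesgue measure on the fundamental domain. -/
noncomputable def quotMeasure (n : ℕ) : Measure (Heis n) :=
  (volume : Measure (Heis n)).restrict (fundDomain n)

/-- Smooth functions on the compact quotient. -/
structure IsTest {n : ℕ} (φ : Heis n → ℂ) : Prop where
  smooth : ContDiff ℝ ∞ φ
  periodic : IsPeriodic φ

/-- The left invariant vector field `Y_{4l+j}`, with `i = (l, j - 1)`: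
`(Y φ)(p) = d/dt φ (p · (t e_i))` at `t = 0`. -/
noncomputable def Y {n : ℕ} (i : Fin n × Fin 4) (φ : Heis n → ℂ) (p : Heis n) : ℂ :=
  deriv (fun t : ℝ => φ (mul p (Pi.single i t, 0))) 0

/-- The complex horizontal vector fields `Z_A^{A'}`. The unprimed index `A = 2l + r`
(`0 ≤ A ≤ 2n - 1`, `r = 0, 1`) is the pair `(l, r)`, the primed index `0'`, `1'` is in `Fin 2`. -/
noncomputable def Z {n : ℕ} (A : Fin n × Fin 2) (A' : Fin 2) (φ : Heis n → ℂ) (p : Heis n) : ℂ :=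
  let y : Fin 4 → ℂ := fun j => Y (A.1, j) φ p
  (!![-y 2 - Complex.I * y 3, -y 0 - Complex.I * y 1;
      y 0 - Complex.I * y 1, -y 2 + Complex.I * y 3] : Matrix (Fin 2) (Fin 2) ℂ) A.2 A'

/-- The index set of the components `f_{A_1 … A_j A'_1 … A'_{k-j}}`. -/
abbrev Idx (n k j : ℕ) : Type := (Fin j → Fin n × Fin 2) × (Fin (k - j) → Fin 2)

/-- The Hermitian space `𝒱_j = ⊙^{k-j} ℂ² ⊗ ⋀^j ℂ²ⁿ`, `j ≤ k`: tuples which are antisymmetric in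
the `j` unprimed indices and symmetric in the `k - j` primed ones, with the inner product that sums
over all values of all indices. -/
def V (n k j : ℕ) : Submodule ℂ (EuclideanSpace ℂ (Idx n k j)) where
  carrier := {v | ∀ (σ : Equiv.Perm (Fin j)) (τ : Equiv.Perm (Fin (k - j)))
    (A : Fin j → Fin n × Fin 2) (P : Fin (k - j) → Fin 2),
    v (A ∘ σ, P ∘ τ) = ((Equiv.Perm.sign σ : ℤ) : ℂ) * v (A, P)}
  zero_mem' := by intro σ τ A P; simp
  add_mem' := by
    intro v w hv hw σ τ A P
    simp only [PiLp.add_apply, hv σ τ A P, hw σ τ A P, mul_add]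
  smul_mem' := by
    intro c v hv σ τ A P
    simp only [PiLp.smul_apply, hv σ τ A P, smul_eq_mul]
    ring

/-- The Hilbert space of square integrable `𝒱_j`-valued functions on the compact quotient. -/
abbrev L2 (n k j : ℕ) : Type := Lp (V n k j) 2 (quotMeasure n)

/-- The component `f_{A_1 … A_j A'_1 … A'_{k-j}}` of `f`. -/
noncomputable def comp {n k j : ℕ} (f : L2 n k j) (a : Idx n k j) (p : Heis n) : ℂ :=
  (f p : EuclideanSpace ℂ (Idx n k j)) a

/-- The primed multi-index `(A', P_1, …, P_{k-j-1})`, for `j < k`. -/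
def consPrimed {k j : ℕ} (A' : Fin 2) (P : Fin (k - (j + 1)) → Fin 2) : Fin (k - j) → Fin 2 :=
  fun i => if h : i.val = 0 then A' else P ⟨i.val - 1, by omega⟩

/-- The distribution `Z_A^{A'} u` on the compact quotient, evaluated at the test function `φ`. -/
noncomputable def distZ {n : ℕ} (A : Fin n × Fin 2) (A' : Fin 2) (u φ : Heis n → ℂ) : ℂ :=
  -∫ p, u p * Z A A' φ p ∂quotMeasure n

/-- The component with index `(A_0 … A_j, P)`, `P = (A'_1, …, A'_{k-j-1})`, of the distribution
`𝒟_j f`, evaluated at the test function `φ`. Here `j < k`, and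
`(𝒟_j f)_{A_0 … A_j P} = (j + 1) ∑_{A'} Z_{[A_0}^{A'} f_{A_1 … A_j] A' P}`, where the square
brackets stand for the normalized antisymmetrization in `A_0, …, A_j`. -/
noncomputable def distD {n k j : ℕ} (f : L2 n k j) (a : Idx n k (j + 1)) (φ : Heis n → ℂ) : ℂ :=
  ((j + 1 : ℕ) : ℂ) * (((j + 1).factorial : ℂ)⁻¹ *
    ∑ σ : Equiv.Perm (Fin (j + 1)), ((Equiv.Perm.sign σ : ℤ) : ℂ) *
      ∑ A' : Fin 2,
        distZ (a.1 (σ 0)) A' (comp f (fun i : Fin j => a.1 (σ i.succ), consPrimed A' a.2)) φ)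

/-- `𝒟_j f = g` in the sense of distributions on the compact quotient. -/
def IsWeakD {n k j : ℕ} (f : L2 n k j) (g : L2 n k (j + 1)) : Prop :=
  ∀ φ : Heis n → ℂ, IsTest φ → ∀ a : Idx n k (j + 1),
    ∫ p, comp g a p * φ p ∂quotMeasure n = distD f a φ

/-! The facts below show that the pairs `(f, 𝒟_j f)` form a linear subspace. -/

theorem mul_single {n : ℕ} (i : Fin n × Fin 4) (p : Heis n) (t : ℝ) :
    mul p (Pi.single i t, 0) = p + t • ((Pi.single i 1 : Fin n × Fin 4 → ℝ),
      fun β : Fin 3 => 2 * ∑ k : Fin 4, B β k i.2 * p.1 (i.1, k)) := by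
  obtain ⟨l₀, j₀⟩ := i
  refine Prod.ext ?_ ?_
  · funext x
    simp [mul, Pi.single_apply]
  · funext β
    have h : ∀ l : Fin n, ∑ k : Fin 4, ∑ j : Fin 4, B β k j * p.1 (l, k) *
        (Pi.single (l₀, j₀) t : Fin n × Fin 4 → ℝ) (l, j) =
        if l = l₀ then t * ∑ k : Fin 4, B β k j₀ * p.1 (l₀, k) else 0 := by
      intro l
      by_cases hl : l = l₀
      · subst hl
        simp [Pi.single_apply, Finset.mul_sum, mul_comm]
      · simp [hl]
    simp only [mul, h, Finset.sum_ite_eq', Finset.mem_univ, if_true]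
    simp
    ring

theorem Y_eq {n : ℕ} (i : Fin n × Fin 4) {φ : Heis n → ℂ} (hφ : ContDiff ℝ ∞ φ) (p : Heis n) :
    Y i φ p = fderiv ℝ φ p ((Pi.single i 1 : Fin n × Fin 4 → ℝ),
      fun β : Fin 3 => 2 * ∑ k : Fin 4, B β k i.2 * p.1 (i.1, k)) := by
  unfold Y
  simp only [mul_single]
  have h : DifferentiableAt ℝ φ p := hφ.differentiable (by simp) p
  exact h.lineDeriv_eq_fderiv

theorem continuous_Y {n : ℕ} (i : Fin n × Fin 4) {φ : Heis n → ℂ} (hφ : ContDiff ℝ ∞ φ) :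
    Continuous (Y i φ) := by
  rw [funext (Y_eq i hφ)]
  exact (hφ.continuous_fderiv (by simp)).clm_apply (by fun_prop)

theorem continuous_Z {n : ℕ} (A : Fin n × Fin 2) (A' : Fin 2) {φ : Heis n → ℂ}
    (hφ : ContDiff ℝ ∞ φ) : Continuous (Z A A' φ) := by
  have h := fun j => continuous_Y (A.1, j) hφ
  obtain ⟨l, r⟩ := A
  fin_cases r <;> fin_cases A' <;> simp +unfoldPartialApp [Z] <;> fun_prop

theorem integrable_comp_mul {n k j : ℕ} (f : L2 n k j) (a : Idx n k j) {ψ : Heis n → ℂ}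
    (hψ : Continuous ψ) : Integrable (fun p => comp f a p * ψ p) (quotMeasure n) := by
  have hK : IsCompact (Set.Icc (0 : Heis n) 1) := isCompact_Icc
  have hsub : fundDomain n ⊆ Set.Icc (0 : Heis n) 1 := fun p hp =>
    ⟨⟨fun i => (hp.1 i).1, fun β => (hp.2 β).1⟩, ⟨fun i => (hp.1 i).2.le, fun β => (hp.2 β).2.le⟩⟩
  have hmeas : MeasurableSet (fundDomain n) := by
    have : fundDomain n = (Set.univ.pi fun _ => Set.Ico (0 : ℝ) 1) ×ˢ
        (Set.univ.pi fun _ => Set.Ico (0 : ℝ) 1) := by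
      ext p; simp [fundDomain, Set.mem_pi]
    rw [this]
    exact (MeasurableSet.univ_pi fun _ => measurableSet_Ico).prod
      (MeasurableSet.univ_pi fun _ => measurableSet_Ico)
  have : IsFiniteMeasure (quotMeasure n) :=
    ⟨by
      rw [quotMeasure, Measure.restrict_apply_univ]
      exact (measure_mono hsub).trans_lt hK.measure_lt_top⟩
  have hf : Integrable (fun p => comp f a p) (quotMeasure n) := by
    have h1 : Integrable (fun p => f p) (quotMeasure n) := (Lp.memLp f).integrable (by norm_num)
    exact ((EuclideanSpace.proj a : EuclideanSpace ℂ (Idx n k j) →L[ℂ] ℂ).comp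
      (V n k j).subtypeL).integrable_comp h1
  obtain ⟨M, hM⟩ := hK.exists_bound_of_continuousOn hψ.continuousOn
  refine hf.mul_bdd (c := M) hψ.aestronglyMeasurable ?_
  exact (ae_restrict_iff' hmeas).2 (Filter.Eventually.of_forall fun p hp => hM p (hsub hp))

theorem integral_comp_add {n k j : ℕ} (f g : L2 n k j) (a : Idx n k j) {ψ : Heis n → ℂ}
    (hψ : Continuous ψ) :
    ∫ p, comp (f + g) a p * ψ p ∂quotMeasure n =
      ∫ p, comp f a p * ψ p ∂quotMeasure n + ∫ p, comp g a p * ψ p ∂quotMeasure n := by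
  rw [← integral_add (integrable_comp_mul f a hψ) (integrable_comp_mul g a hψ)]
  refine integral_congr_ae ?_
  filter_upwards [Lp.coeFn_add f g] with p hp
  simp only [comp, hp, Pi.add_apply, Submodule.coe_add, PiLp.add_apply, add_mul]

theorem integral_comp_smul {n k j : ℕ} (c : ℂ) (f : L2 n k j) (a : Idx n k j) (ψ : Heis n → ℂ) :
    ∫ p, comp (c • f) a p * ψ p ∂quotMeasure n = c * ∫ p, comp f a p * ψ p ∂quotMeasure n := by
  rw [← integral_const_mul]
  refine integral_congr_ae ?_
  filter_upwards [Lp.coeFn_smul c f] with p hp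
  simp [comp, hp, mul_assoc]

/-- The graph of the operator `𝒟_j : L² → L²`, `j < k`, with its maximal domain: all `(f, g)` such
that `f` and `g` are square integrable and `𝒟_j f = g` in the sense of distributions. -/
def graphD (n k j : ℕ) : Submodule ℂ (L2 n k j × L2 n k (j + 1)) where
  carrier := {x | IsWeakD x.1 x.2}
  zero_mem' := by
    intro φ hφ a
    have h : ∀ (m : ℕ) (b : Idx n k m) (ψ : Heis n → ℂ),
        ∫ p, comp (0 : L2 n k m) b p * ψ p ∂quotMeasure n = 0 := by
      intro m b ψ
      simpa using integral_comp_smul 0 (0 : L2 n k m) b ψ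
    simp only [distD, distZ, Prod.fst_zero, Prod.snd_zero, h]
    simp
  add_mem' := by
    intro x y hx hy φ hφ a
    have hZ := fun A A' => continuous_Z A A' hφ.smooth
    rw [Prod.snd_add, integral_comp_add _ _ _ hφ.smooth.continuous, hx φ hφ a, hy φ hφ a]
    simp only [distD, distZ, Prod.fst_add, integral_comp_add _ _ _ (hZ _ _), ← mul_add,
      ← Finset.sum_add_distrib, neg_add]
  smul_mem' := by
    intro c x hx φ hφ a
    rw [Prod.smul_snd, integral_comp_smul, hx φ hφ a]
    simp only [distD, distZ, Prod.smul_fst, integral_comp_smul, Finset.mul_sum]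
    refine Finset.sum_congr rfl fun σ _ => Finset.sum_congr rfl fun A' _ => ?_
    ring

/-- The graph of the Hilbert space adjoint `𝒟_j^* : L² → L²`, `j < k`: all `(f, u)` with
`⟨𝒟_j h, f⟩ = ⟨h, u⟩` for every `h` in the maximal domain of `𝒟_j`. -/
noncomputable def graphDStar (n k j : ℕ) : Submodule ℂ (L2 n k (j + 1) × L2 n k j) :=
  Submodule.adjoint (𝕜 := ℂ) (E := L2 n k j) (F := L2 n k (j + 1)) (graphD n k j)

/-- `f` is orthogonal to the constant vectors. -/
def OrthConst {n k j : ℕ} (f : L2 n k j) : Prop :=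
  ∀ C : V n k j, ∫ p, inner ℂ C (f p) ∂quotMeasure n = 0

end TangentialCF

open TangentialCF

namespace TangentialCF

/-! ### The group law -/

/-! Right translations `U g` form a unitary representation of the group on L² of the quotient, and
the fields Y_a are its infinitesimal generators. For smooth vectors the bound is the composition of
two inequalities: a Weitzenböck inequality 2(1 - 3/n) ∑ ‖Y_a f_i‖² ≤ ‖𝒟₁f‖² + 2‖𝒟₀^*f‖²
(`HeisRel.weitzenboeck`) and a subelliptic Poincaré inequality ‖F‖² ≤ 676 n ∑ ‖Y_a F‖² for F of mean
zero (`norm_sq_le_of_integral_eq_zero`).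

Weitzenböck: with X_{AB} = ∑ Z_A^{A'} f_{BA'}, 𝒟₁f is X_{AB} - X_{BA}, so ‖𝒟₁f‖² is 2‖X‖² minus
twice the real part of ⟨X_{AB}, X_{BA}⟩. On each quaternionic line the commutators in ‖X‖² cancel,
and ‖X‖² is exactly the horizontal energy (`HeisRel.sum_norm_xComb`). In the cross term, integration
by parts interchanges the two operators. It leaves commutators and the pairing of the unsymmetrized
divergence W of f with W after transposition of its first two primed indices. The real part of this
pairing is at most the squared norm of the symmetrization of W, which is 𝒟₀^*f
(`re_sum_inner_swap_le`). The commutators are central derivatives. Since each central field is a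
commutator on every one of the n quaternionic lines, averaging over the lines gains a factor 1/n,
and the total is at most 3/n times the energy (`HeisRel.norm_commTerm_le`). This is where n > 3
enters.

Poincaré: a central element is a group commutator of horizontal ones, so translation by any point of
the fundamental domain moves F by at most 13 ∑ ‖Y_a F‖. For F of mean zero the average of ⟨F, U g F⟩
over g vanishes (`integral_inner_U`), so these displacements control ‖F‖.

The passage to the maximal domains is a Friedrichs argument with the mollifications ∫ ψ(g) U(g) f
dg. As U(g) does not commute with Y_a, mollifying a distributional equation creates errors: central
derivatives of a linear coefficient times ψ (`sum_smul_gen_eq`). Under isotropic dilations of ψ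
these kernels are only rescaled and keep integral zero, so the errors tend to 0 strongly
(`tendsto_moll_shear`). -/

/-- The components of the bilinear form `Im (x * conj y)`. -/
def omega {n : ℕ} (β : Fin 3) (x y : Fin n × Fin 4 → ℝ) : ℝ :=
  ∑ l : Fin n, ∑ k : Fin 4, ∑ j : Fin 4, B β k j * x (l, k) * y (l, j)

section omega
variable {n : ℕ} (β : Fin 3) (x y z : Fin n × Fin 4 → ℝ)

theorem omega_add_left : omega β (x + y) z = omega β x z + omega β y z := by
  simp only [omega, Pi.add_apply, ← Finset.sum_add_distrib]
  refine Finset.sum_congr rfl fun _ _ => Finset.sum_congr rfl fun _ _ =>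
    Finset.sum_congr rfl fun _ _ => by ring

theorem omega_add_right : omega β x (y + z) = omega β x y + omega β x z := by
  simp only [omega, Pi.add_apply, ← Finset.sum_add_distrib]
  refine Finset.sum_congr rfl fun _ _ => Finset.sum_congr rfl fun _ _ =>
    Finset.sum_congr rfl fun _ _ => by ring

theorem omega_smul_left (c : ℝ) : omega β (c • x) y = c * omega β x y := by
  simp only [omega, Pi.smul_apply, smul_eq_mul, Finset.mul_sum]
  refine Finset.sum_congr rfl fun _ _ => Finset.sum_congr rfl fun _ _ =>
    Finset.sum_congr rfl fun _ _ => by ring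

theorem omega_smul_right (c : ℝ) : omega β x (c • y) = c * omega β x y := by
  simp only [omega, Pi.smul_apply, smul_eq_mul, Finset.mul_sum]
  refine Finset.sum_congr rfl fun _ _ => Finset.sum_congr rfl fun _ _ =>
    Finset.sum_congr rfl fun _ _ => by ring

theorem omega_swap : omega β y x = -omega β x y := by
  simp only [omega, ← Finset.sum_neg_distrib]
  refine Finset.sum_congr rfl fun l _ => ?_
  fin_cases β <;> simp [B, Fin.sum_univ_four] <;> ring

@[simp] theorem omega_self : omega β x x = 0 := by
  have := omega_swap β x x
  linarith

@[simp] theorem omega_zero_left : omega β 0 x = 0 := by simp [omega]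

@[simp] theorem omega_zero_right : omega β x 0 = 0 := by simp [omega]

theorem omega_neg_left : omega β (-x) y = -omega β x y := by
  simpa using omega_smul_left β x y (-1)

theorem omega_neg_right : omega β x (-y) = -omega β x y := by
  simpa using omega_smul_right β x y (-1)

theorem exists_int_omega (a b : Fin n × Fin 4 → ℤ) :
    ∃ z : ℤ, omega β (fun i => (a i : ℝ)) (fun i => (b i : ℝ)) = z := by
  have hB : ∀ β k j, ∃ z : ℤ, B β k j = z := by
    intro β k j
    fin_cases β <;> fin_cases k <;> fin_cases j <;>
      first
      | (refine ⟨0, ?_⟩; simp [B]; done)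
      | (refine ⟨1, ?_⟩; simp [B]; done)
      | (refine ⟨-1, ?_⟩; simp [B]; done)
  choose z hz using hB
  refine ⟨∑ l : Fin n, ∑ k : Fin 4, ∑ j : Fin 4, z β k j * a (l, k) * b (l, j), ?_⟩
  simp [omega, hz]

end omega

variable {n : ℕ}

theorem mul_eq (p q : Heis n) :
    mul p q = (p.1 + q.1, fun β => p.2 β + q.2 β + 2 * omega β p.1 q.1) := rfl

theorem mul_assoc' (p q r : Heis n) : mul (mul p q) r = mul p (mul q r) := by
  simp only [mul_eq, omega_add_left, omega_add_right]
  refine Prod.ext (add_assoc _ _ _) (funext fun β => ?_)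
  simp only
  ring

@[simp] theorem mul_zero' (p : Heis n) : mul p 0 = p := by
  simp [mul_eq]

@[simp] theorem zero_mul' (p : Heis n) : mul 0 p = p := by
  simp [mul_eq]

@[simp] theorem mul_neg_self (p : Heis n) : mul p (-p) = 0 := by
  refine Prod.ext ?_ (funext fun β => ?_) <;> simp [mul_eq, omega_neg_right]

@[simp] theorem neg_mul_self (p : Heis n) : mul (-p) p = 0 := by
  refine Prod.ext ?_ (funext fun β => ?_) <;> simp [mul_eq, omega_neg_left]

theorem smul_mul_smul (s t : ℝ) (p : Heis n) : mul (s • p) (t • p) = (s + t) • p := by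
  refine Prod.ext ?_ (funext fun β => ?_)
  · simp [mul_eq, add_smul]
  · simp [mul_eq, omega_smul_left, omega_smul_right, add_mul]

theorem contDiff_omega (β : Fin 3) {E : Type*} [NormedAddCommGroup E] [NormedSpace ℝ E]
    {m : WithTop ℕ∞} {f g : E → Fin n × Fin 4 → ℝ} (hf : ContDiff ℝ m f) (hg : ContDiff ℝ m g) :
    ContDiff ℝ m fun e => omega β (f e) (g e) := by
  rw [contDiff_pi] at hf hg
  unfold omega
  refine ContDiff.sum fun l _ => ContDiff.sum fun k _ => ContDiff.sum fun j _ => ?_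
  exact (contDiff_const.mul (hf _)).mul (hg _)

theorem contDiff_mul {E : Type*} [NormedAddCommGroup E] [NormedSpace ℝ E]
    {m : WithTop ℕ∞} {f g : E → Heis n} (hf : ContDiff ℝ m f) (hg : ContDiff ℝ m g) :
    ContDiff ℝ m fun e => mul (f e) (g e) := by
  simp only [mul_eq]
  refine (hf.fst.add hg.fst).prodMk (contDiff_pi.2 fun β => ?_)
  have h1 := contDiff_pi.1 hf.snd β
  have h2 := contDiff_pi.1 hg.snd β
  exact (h1.add h2).add (contDiff_const.mul (contDiff_omega β hf.fst hg.fst))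

theorem continuous_mul' {X : Type*} [TopologicalSpace X] {f g : X → Heis n} (hf : Continuous f)
    (hg : Continuous g) : Continuous fun e => mul (f e) (g e) :=
  (contDiff_mul (m := 0) (E := Heis n × Heis n) contDiff_fst contDiff_snd).continuous.comp
    (hf.prodMk hg)

/-! ### Reduction to the fundamental domain -/

/-- The representative in the fundamental domain of the orbit of a point under the lattice. -/
noncomputable def red (p : Heis n) : Heis n :=
  (fun i => Int.fract (p.1 i),
    fun β => Int.fract (p.2 β - 2 * omega β (fun i => (⌊p.1 i⌋ : ℝ)) p.1))

theorem red_mem (p : Heis n) : red p ∈ fundDomain n :=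
  ⟨fun _ => ⟨Int.fract_nonneg _, Int.fract_lt_one _⟩,
    fun _ => ⟨Int.fract_nonneg _, Int.fract_lt_one _⟩⟩

theorem red_eq_self {p : Heis n} (hp : p ∈ fundDomain n) : red p = p := by
  have h1 : ∀ i, ⌊p.1 i⌋ = 0 := fun i => Int.floor_eq_zero_iff.2 (hp.1 i)
  have h3 : ∀ β, omega β (fun i => (⌊p.1 i⌋ : ℝ)) p.1 = 0 := by
    intro β; simp only [h1]; simp [omega]
  refine Prod.ext (funext fun i => Int.fract_eq_self.2 (hp.1 i)) (funext fun β => ?_)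
  simp only [red, h3 β]
  simpa using Int.fract_eq_self.2 (hp.2 β)

theorem exists_red_eq (p : Heis n) : ∃ a m, red p = mul (latticePoint a m) p := by
  refine ⟨fun i => -⌊p.1 i⌋, fun β => -⌊p.2 β - 2 * omega β (fun i => (⌊p.1 i⌋ : ℝ)) p.1⌋, ?_⟩
  refine Prod.ext (funext fun i => ?_) (funext fun β => ?_)
  · simp only [red, mul_eq, latticePoint, Int.fract, Pi.add_apply]
    push_cast
    ring
  · have : (fun i => ((-⌊p.1 i⌋ : ℤ) : ℝ)) = -fun i => (⌊p.1 i⌋ : ℝ) := by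
      funext i; simp
    simp only [red, mul_eq, latticePoint, Int.fract, this, omega_neg_left]
    push_cast
    ring

/-- The vertical coordinates before taking fractional parts differ by m - 2ω(⌊x⌋, a), an integer
because ω is integral on the lattice. Hence `red` depends only on the orbit. -/
theorem red_lattice_mul (a : Fin n × Fin 4 → ℤ) (m : Fin 3 → ℤ) (p : Heis n) :
    red (mul (latticePoint a m) p) = red p := by
  refine Prod.ext (funext fun i => ?_) (funext fun β => ?_)
  · simp [red, mul_eq, latticePoint]
  · simp only [red, mul_eq, latticePoint, Pi.add_apply, Int.floor_intCast_add]
    have h : (fun i => ((a i + ⌊p.1 i⌋ : ℤ) : ℝ)) =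
        (fun i => (a i : ℝ)) + fun i => (⌊p.1 i⌋ : ℝ) := by funext i; simp
    obtain ⟨z, hz⟩ := exists_int_omega β (fun i => ⌊p.1 i⌋) a
    rw [h, omega_add_left, omega_add_right, omega_add_right, omega_self, hz]
    rw [Int.fract_eq_fract]
    exact ⟨m β - 2 * z, by push_cast; ring⟩

theorem red_mul_red (p q : Heis n) : red (mul (red p) q) = red (mul p q) := by
  obtain ⟨a, m, h⟩ := exists_red_eq p
  rw [h, mul_assoc', red_lattice_mul]

theorem IsPeriodic.red {α : Type*} {φ : Heis n → α} (hφ : IsPeriodic φ) (p : Heis n) :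
    φ (red p) = φ p := by
  obtain ⟨a, m, h⟩ := exists_red_eq p
  rw [h, hφ]

/-! ### Invariance of the measure -/

theorem measurable_omega (β : Fin 3) {X : Type*} [MeasurableSpace X]
    {f g : X → Fin n × Fin 4 → ℝ} (hf : Measurable f) (hg : Measurable g) :
    Measurable fun e => omega β (f e) (g e) := by
  unfold omega
  fun_prop

theorem measurable_mul' {X : Type*} [MeasurableSpace X] {f g : X → Heis n} (hf : Measurable f)
    (hg : Measurable g) : Measurable fun e => mul (f e) (g e) :=
  (continuous_mul' (X := Heis n × Heis n) continuous_fst continuous_snd).measurable.comp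
    (hf.prodMk hg)

theorem measurable_red : Measurable (red : Heis n → Heis n) := by
  unfold red
  refine (measurable_pi_lambda _ fun i => ?_).prodMk (measurable_pi_lambda _ fun β => ?_)
  · fun_prop
  · refine Measurable.fract (Measurable.sub (by fun_prop) (Measurable.const_mul
      (measurable_omega β ?_ (by fun_prop)) _))
    refine measurable_pi_lambda _ fun i => ?_
    exact (measurable_of_countable (fun z : ℤ => (z : ℝ))).comp
      (Int.measurable_floor.comp (by fun_prop))

/-- The intervals from 0 to 1 and from c to c + 1 are both fundamental domains for ℤ in ℝ, so they
give the same measure to a ℤ-invariant set. -/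
theorem measurePreserving_fract_add (c : ℝ) :
    MeasurePreserving (fun x : ℝ => Int.fract (x + c))
      (volume.restrict (Set.Ico 0 1)) (volume.restrict (Set.Ico 0 1)) := by
  have hm : Measurable (fun x : ℝ => Int.fract (x + c)) := by fun_prop
  refine ⟨hm, Measure.ext fun s hs => ?_⟩
  have hf : MeasurableSet (Int.fract ⁻¹' s : Set ℝ) := measurable_fract hs
  have key : ∀ t : ℝ, volume (Int.fract ⁻¹' s ∩ Set.Ico t (t + 1)) =
      volume (Int.fract ⁻¹' s ∩ Set.Ioc t (t + 1)) := fun t =>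
    measure_congr ((Filter.EventuallyEq.refl _ _).inter Ico_ae_eq_Ioc)
  have h2 := (isAddFundamentalDomain_Ioc zero_lt_one 0).measure_set_eq (μ := volume)
    (isAddFundamentalDomain_Ioc (zero_lt_one (α := ℝ)) c) hf (by
      rintro ⟨g, hg⟩
      obtain ⟨z, rfl⟩ := AddSubgroup.mem_zmultiples_iff.1 hg
      ext x
      simp [AddSubgroup.vadd_def])
  rw [Measure.map_apply hm hs, Measure.restrict_apply (hm hs), Measure.restrict_apply hs]
  have e1 : (fun x : ℝ => Int.fract (x + c)) ⁻¹' s ∩ Set.Ico 0 1 =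
      (· + c) ⁻¹' (Int.fract ⁻¹' s ∩ Set.Ico c (c + 1)) := by
    ext x; simp [add_comm c]
  have e2 : s ∩ Set.Ico 0 1 = Int.fract ⁻¹' s ∩ Set.Ico 0 (0 + 1) := by
    ext x
    simp only [Set.mem_inter_iff, Set.mem_preimage, zero_add]
    refine and_congr_left fun hx => ?_
    rw [Int.fract_eq_self.2 hx]
  rw [e1, measure_preimage_add_right, key, e2, key, h2]

theorem measurePreserving_fract_add_pi {ι : Type*} [Fintype ι] (c : ι → ℝ) :
    MeasurePreserving (fun (x : ι → ℝ) i => Int.fract (x i + c i))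
      (Measure.pi fun _ => volume.restrict (Set.Ico 0 1))
      (Measure.pi fun _ => volume.restrict (Set.Ico 0 1)) :=
  measurePreserving_pi _ _ fun i => measurePreserving_fract_add (c i)

theorem fundDomain_eq : fundDomain n =
    (Set.univ.pi fun _ => Set.Ico (0 : ℝ) 1) ×ˢ (Set.univ.pi fun _ => Set.Ico (0 : ℝ) 1) := by
  ext p; simp [fundDomain, Set.mem_pi]

theorem measurableSet_fundDomain : MeasurableSet (fundDomain n) := by
  rw [fundDomain_eq]
  exact (MeasurableSet.univ_pi fun _ => measurableSet_Ico).prod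
    (MeasurableSet.univ_pi fun _ => measurableSet_Ico)

theorem quotMeasure_eq : quotMeasure n =
    (Measure.pi fun _ => volume.restrict (Set.Ico 0 1)).prod
      (Measure.pi fun _ => volume.restrict (Set.Ico 0 1)) := by
  rw [quotMeasure, fundDomain_eq, Measure.volume_eq_prod, ← Measure.prod_restrict, volume_pi,
    volume_pi, Measure.restrict_pi_pi, Measure.restrict_pi_pi]

instance : IsProbabilityMeasure (volume.restrict (Set.Ico (0 : ℝ) 1)) := ⟨by simp⟩

instance : IsProbabilityMeasure (quotMeasure n) := by
  rw [quotMeasure_eq]; infer_instance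

theorem ae_mem_fundDomain : ∀ᵐ p ∂quotMeasure n, p ∈ fundDomain n :=
  ae_restrict_mem measurableSet_fundDomain

/-- After reduction such a map is a rotation of the horizontal torus followed, over each base point,
by a rotation of the vertical torus. Fubini for skew products applies; left and right translations
are both of this form. -/
theorem measurePreserving_red_of_skew {F : Heis n → Heis n} (hF : Measurable F)
    (c : Fin n × Fin 4 → ℝ) (d : (Fin n × Fin 4 → ℝ) → Fin 3 → ℝ)
    (h1 : ∀ p, (F p).1 = p.1 + c) (h2 : ∀ p, (F p).2 = p.2 + d p.1) :
    MeasurePreserving (fun p => red (F p)) (quotMeasure n) (quotMeasure n) := by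
  have hm : Measurable fun p => red (F p) := measurable_red.comp hF
  have e : (fun p => red (F p)) = fun p : Heis n => ((fun i => Int.fract (p.1 i + c i)),
      (fun β => Int.fract (p.2 β + (d p.1 β -
        2 * omega β (fun i => (⌊p.1 i + c i⌋ : ℝ)) (p.1 + c))))) := by
    funext p
    refine Prod.ext (funext fun i => ?_) (funext fun β => ?_)
    · simp [red, h1]
    · simp [red, h1, h2, add_sub_assoc]
  rw [e] at hm ⊢
  rw [quotMeasure_eq]
  refine (measurePreserving_fract_add_pi c).skew_product
    (g := fun x (t : Fin 3 → ℝ) β => Int.fract (t β + (d x β -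
        2 * omega β (fun i => (⌊x i + c i⌋ : ℝ)) (x + c)))) hm.snd ?_
  exact Filter.Eventually.of_forall fun x => (measurePreserving_fract_add_pi _).map_eq

theorem measurePreserving_red_mul_right (g : Heis n) :
    MeasurePreserving (fun p => red (mul p g)) (quotMeasure n) (quotMeasure n) :=
  measurePreserving_red_of_skew (measurable_mul' measurable_id measurable_const) g.1
    (fun x β => g.2 β + 2 * omega β x g.1) (fun p => rfl)
    fun p => funext fun β => by simp [mul_eq, add_assoc]

/-- A left translation by a general element does not descend to the quotient, but on the unit cube
it is still a skew product of rotations. It is needed for the averaging in `integral_inner_U`. -/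
theorem measurePreserving_red_mul_left (g : Heis n) :
    MeasurePreserving (fun p => red (mul g p)) (quotMeasure n) (quotMeasure n) :=
  measurePreserving_red_of_skew (measurable_mul' measurable_const measurable_id) g.1
    (fun x β => g.2 β + 2 * omega β g.1 x) (fun p => by simp [mul_eq, add_comm])
    fun p => funext fun β => by simp [mul_eq]; ring

theorem measurePreserving_mul_left (g : Heis n) :
    MeasurePreserving (fun p => mul g p) (volume : Measure (Heis n)) volume := by
  rw [Measure.volume_eq_prod]
  have h1 := measurePreserving_add_left (volume : Measure (Fin n × Fin 4 → ℝ)) g.1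
  have hm : Measurable fun p => mul g p := measurable_mul' measurable_const measurable_id
  refine h1.skew_product (g := fun x (t : Fin 3 → ℝ) β => g.2 β + t β + 2 * omega β g.1 x) hm.snd ?_
  refine Filter.Eventually.of_forall fun x => ?_
  have h2 := measurePreserving_add_left (volume : Measure (Fin 3 → ℝ))
    (g.2 + fun β => 2 * omega β g.1 x)
  have e : (fun (t : Fin 3 → ℝ) β => g.2 β + t β + 2 * omega β g.1 x) =
      fun t => (g.2 + fun β => 2 * omega β g.1 x) + t := by
    funext t β
    simp
    ring
  rw [e]
  exact h2.map_eq

end TangentialCF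

namespace TangentialCF
open Filter Topology ComplexConjugate

variable {n : ℕ}

/-! ### The right regular representation -/

/-- Square integrable scalar functions on the compact quotient. -/
abbrev SL2 (n : ℕ) : Type := Lp ℂ 2 (quotMeasure n)

/-- Right translation of square integrable functions on the compact quotient. -/
noncomputable def U (g : Heis n) : SL2 n →ₗᵢ[ℂ] SL2 n :=
  Lp.compMeasurePreservingₗᵢ ℂ _ (measurePreserving_red_mul_right g)

theorem coeFn_U (g : Heis n) (f : SL2 n) :
    U g f =ᵐ[quotMeasure n] fun p => f (red (mul p g)) :=
  Lp.coeFn_compMeasurePreserving f (measurePreserving_red_mul_right g)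

theorem U_mul (g h : Heis n) (f : SL2 n) : U (mul g h) f = U g (U h f) := by
  refine Lp.ext ?_
  filter_upwards [coeFn_U (mul g h) f, coeFn_U g (U h f),
    (measurePreserving_red_mul_right g).quasiMeasurePreserving.ae (coeFn_U h f)] with p h1 h2 h3
  rw [h1, h2, h3, red_mul_red, mul_assoc']

@[simp] theorem U_zero (f : SL2 n) : U 0 f = f := by
  refine Lp.ext ?_
  filter_upwards [coeFn_U 0 f, ae_mem_fundDomain] with p h1 h2
  rw [h1, mul_zero', red_eq_self h2]

theorem inner_U_left (g : Heis n) (f h : SL2 n) :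
    inner ℂ (U g f) h = inner ℂ f (U (-g) h) := by
  rw [← (U (-g)).inner_map_map (U g f) h, ← U_mul, neg_mul_self, U_zero]

/-! ### Continuous functions and test functions -/

theorem exists_bound_fundDomain {φ : Heis n → ℂ} (hφ : Continuous φ) :
    ∃ M, ∀ p ∈ fundDomain n, ‖φ p‖ ≤ M := by
  obtain ⟨M, hM⟩ := (isCompact_Icc : IsCompact (Set.Icc (0 : Heis n) 1)).exists_bound_of_continuousOn
    hφ.continuousOn
  exact ⟨M, fun p hp => hM p
    ⟨⟨fun i => (hp.1 i).1, fun β => (hp.2 β).1⟩, ⟨fun i => (hp.1 i).2.le, fun β => (hp.2 β).2.le⟩⟩⟩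

theorem memLp_of_continuous {φ : Heis n → ℂ} (hφ : Continuous φ) : MemLp φ 2 (quotMeasure n) := by
  obtain ⟨M, hM⟩ := exists_bound_fundDomain hφ
  refine MemLp.of_bound hφ.aestronglyMeasurable M ?_
  filter_upwards [ae_mem_fundDomain] with p hp using hM p hp

/-- The class in `L²` of a continuous function. -/
noncomputable def cls (φ : Heis n → ℂ) (hφ : Continuous φ) : SL2 n :=
  (memLp_of_continuous hφ).toLp φ

theorem coeFn_cls {φ : Heis n → ℂ} (hφ : Continuous φ) : cls φ hφ =ᵐ[quotMeasure n] φ :=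
  MemLp.coeFn_toLp _

theorem inner_cls {φ : Heis n → ℂ} (hφ : Continuous φ) (f : SL2 n) :
    inner ℂ (cls φ hφ) f = ∫ p, conj (φ p) * f p ∂quotMeasure n := by
  rw [L2.inner_def]
  refine integral_congr_ae ?_
  filter_upwards [coeFn_cls hφ] with p hp
  rw [hp, RCLike.inner_apply, mul_comm]

theorem IsTest.continuous {φ : Heis n → ℂ} (hφ : IsTest φ) : Continuous φ := hφ.smooth.continuous

theorem isTest_comp_mul {φ : Heis n → ℂ} (hφ : IsTest φ) (g : Heis n) :
    IsTest fun p => φ (mul p g) :=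
  ⟨hφ.smooth.comp (contDiff_mul contDiff_id contDiff_const),
    fun a m p => by rw [mul_assoc', hφ.periodic]⟩

theorem IsTest.conj {φ : Heis n → ℂ} (hφ : IsTest φ) : IsTest fun p => conj (φ p) :=
  ⟨(Complex.conjCLE.contDiff (n := ∞)).comp hφ.smooth, fun a m p => by rw [hφ.periodic]⟩

theorem IsTest.mul {φ χ : Heis n → ℂ} (hφ : IsTest φ) (hχ : IsTest χ) :
    IsTest fun p => φ p * χ p :=
  ⟨hφ.smooth.mul hχ.smooth, fun a m p => by rw [hφ.periodic, hχ.periodic]⟩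

theorem U_cls {φ : Heis n → ℂ} (hφ : Continuous φ) (hp : IsPeriodic φ) (g : Heis n) :
    U g (cls φ hφ) =
      cls (fun p => φ (mul p g)) (hφ.comp (continuous_mul' continuous_id continuous_const)) := by
  refine Lp.ext ?_
  filter_upwards [coeFn_U g (cls φ hφ), coeFn_cls (hφ.comp (continuous_mul' continuous_id
    (continuous_const (y := g)))), (measurePreserving_red_mul_right g).quasiMeasurePreserving.ae
    (coeFn_cls hφ)] with p h1 h2 h3
  rw [h1, h3, hp.red]
  exact h2.symm

/-! ### Density of test functions -/

/-- Near 0 the fractional part is close either to 0 or to 1, and both are at positive distance from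
C. -/
theorem eventually_fract_notMem {C : Set ℝ} (hC : IsClosed C) (h0 : (0 : ℝ) ∉ C)
    (h1 : (1 : ℝ) ∉ C) : ∀ᶠ x in 𝓝 (0 : ℝ), Int.fract x ∉ C := by
  have e0 : ∀ᶠ x in 𝓝 (0 : ℝ), x ∉ C := hC.isOpen_compl.mem_nhds h0
  have e1 : ∀ᶠ x in 𝓝 (0 : ℝ), x + 1 ∉ C := by
    have : Tendsto (fun x : ℝ => x + 1) (𝓝 0) (𝓝 1) := by
      have h : Continuous fun x : ℝ => x + 1 := by fun_prop
      simpa using h.tendsto 0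
    exact this.eventually (hC.isOpen_compl.mem_nhds h1)
  filter_upwards [e0, e1, Ioo_mem_nhds (show (-1 : ℝ) < 0 by norm_num) one_pos] with x h h' hx
  rcases le_or_gt 0 x with hx0 | hx0
  · rwa [Int.fract_eq_self.2 ⟨hx0, hx.2⟩]
  · rwa [show Int.fract x = x + 1 from Int.fract_eq_iff.2
      ⟨by linarith [hx.1], by linarith, -1, by push_cast; ring⟩]

/-- The open unit cube. -/
def openCube (n : ℕ) : Set (Heis n) :=
  {p | (∀ i, p.1 i ∈ Set.Ioo (0 : ℝ) 1) ∧ ∀ β, p.2 β ∈ Set.Ioo (0 : ℝ) 1}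

theorem isOpen_openCube : IsOpen (openCube n) := by
  have : openCube n =
    (Set.univ.pi fun _ => Set.Ioo (0 : ℝ) 1) ×ˢ (Set.univ.pi fun _ => Set.Ioo (0 : ℝ) 1) := by
    ext p; simp [openCube, Set.mem_pi]
  rw [this]
  exact (isOpen_set_pi Set.finite_univ fun _ _ => isOpen_Ioo).prod
    (isOpen_set_pi Set.finite_univ fun _ _ => isOpen_Ioo)

theorem openCube_subset : openCube n ⊆ fundDomain n := fun _ hp =>
  ⟨fun i => Set.Ioo_subset_Ico_self (hp.1 i), fun β => Set.Ioo_subset_Ico_self (hp.2 β)⟩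

theorem openCube_ae_eq : openCube n =ᵐ[volume] fundDomain n := by
  have h1 : openCube n =
    (Set.univ.pi fun _ => Set.Ioo (0 : ℝ) 1) ×ˢ (Set.univ.pi fun _ => Set.Ioo (0 : ℝ) 1) := by
    ext p; simp [openCube, Set.mem_pi]
  rw [h1, fundDomain_eq, Measure.volume_eq_prod]
  exact Measure.set_prod_ae_eq (Measure.ae_eq_set_pi fun _ _ => Ioo_ae_eq_Ico)
    (Measure.ae_eq_set_pi fun _ _ => Ioo_ae_eq_Ico)

/-- By invariance it suffices to look near points of the fundamental domain. In the open cube `red`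
is the identity. Near a point of a boundary face, reduced points stay close to opposite faces of the
cube, away from the compact support of g, so the function vanishes there. -/
theorem isTest_periodization {g : Heis n → ℝ} (hg : ContDiff ℝ ∞ g) (hc : HasCompactSupport g)
    (hs : tsupport g ⊆ openCube n) : IsTest fun p => (g (red p) : ℂ) := by
  refine ⟨?_, fun a m p => by rw [red_lattice_mul]⟩
  suffices h : ContDiff ℝ ∞ fun p => g (red p) from Complex.ofRealCLM.contDiff.comp h
  suffices h : ∀ p ∈ fundDomain n, ContDiffAt ℝ ∞ (fun p => g (red p)) p by
    rw [contDiff_iff_contDiffAt]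
    intro p
    obtain ⟨a, m, e⟩ := exists_red_eq p
    have h1 : (fun p => g (red p)) = (fun p => g (red p)) ∘ mul (latticePoint a m) := by
      funext q; simp [red_lattice_mul]
    rw [h1]
    refine ContDiffAt.comp p ?_ (contDiff_mul contDiff_const contDiff_id).contDiffAt
    rw [← e]
    exact h _ (red_mem p)
  intro p hp
  have hzero : ∀ (q : Heis n), red q ∉ tsupport g → g (red q) = 0 := fun q hq =>
    image_eq_zero_of_notMem_tsupport hq
  -- The horizontal faces are split off first: when all horizontal coordinates are interior, their
  -- floors vanish nearby, so `red` does not shear and acts on the vertical coordinates by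
  -- fractional part alone.
  by_cases h1 : ∀ i, 0 < p.1 i
  · have ev1 : ∀ᶠ q : Heis n in 𝓝 p, ∀ i, q.1 i ∈ Set.Ioo (0 : ℝ) 1 := by
      refine eventually_all.2 fun i => ?_
      have : Continuous fun q : Heis n => q.1 i := by fun_prop
      exact this.continuousAt.eventually (Ioo_mem_nhds (h1 i) (hp.1 i).2)
    have hred : ∀ q : Heis n, (∀ i, q.1 i ∈ Set.Ioo (0 : ℝ) 1) →
        red q = (q.1, fun β => Int.fract (q.2 β)) := by
      intro q hq
      have hf : ∀ i, ⌊q.1 i⌋ = 0 := fun i =>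
        Int.floor_eq_zero_iff.2 (Set.Ioo_subset_Ico_self (hq i))
      refine Prod.ext (funext fun i =>
        Int.fract_eq_self.2 (Set.Ioo_subset_Ico_self (hq i))) (funext fun β => ?_)
      simp only [red, hf]
      simp [omega]
    by_cases h2 : ∀ β, 0 < p.2 β
    · have hpo : p ∈ openCube n := ⟨fun i => ⟨h1 i, (hp.1 i).2⟩, fun β => ⟨h2 β, (hp.2 β).2⟩⟩
      refine hg.contDiffAt.congr_of_eventuallyEq ?_
      filter_upwards [isOpen_openCube.mem_nhds hpo] with q hq
      rw [red_eq_self (openCube_subset hq)]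
    · push Not at h2
      obtain ⟨β, hβ⟩ := h2
      have hβ0 : p.2 β = 0 := le_antisymm hβ (hp.2 β).1
      refine (contDiffAt_const (c := (0 : ℝ))).congr_of_eventuallyEq ?_
      have hc1 : Continuous fun q : Heis n => q.2 β := by fun_prop
      have hK := (hc.isCompact.image hc1).isClosed
      have := eventually_fract_notMem hK
        (by rintro ⟨q, hq, h⟩; exact absurd h ((hs hq).2 β).1.ne')
        (by rintro ⟨q, hq, h⟩; exact absurd h ((hs hq).2 β).2.ne)
      have h3 : Tendsto (fun q : Heis n => q.2 β) (𝓝 p) (𝓝 0) := hβ0 ▸ hc1.tendsto p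
      filter_upwards [ev1, h3.eventually this] with q hq hq'
      refine hzero q fun hmem => hq' ⟨_, hmem, ?_⟩
      simp [hred q hq]
  · push Not at h1
    obtain ⟨i, hi⟩ := h1
    have hi0 : p.1 i = 0 := le_antisymm hi (hp.1 i).1
    refine (contDiffAt_const (c := (0 : ℝ))).congr_of_eventuallyEq ?_
    have hc1 : Continuous fun q : Heis n => q.1 i := by fun_prop
    have hK := (hc.isCompact.image hc1).isClosed
    have := eventually_fract_notMem hK
      (by rintro ⟨q, hq, h⟩; exact absurd h ((hs hq).1 i).1.ne')
      (by rintro ⟨q, hq, h⟩; exact absurd h ((hs hq).1 i).2.ne)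
    have h3 : Tendsto (fun q : Heis n => q.1 i) (𝓝 p) (𝓝 0) := hi0 ▸ hc1.tendsto p
    filter_upwards [h3.eventually this] with q hq'
    exact hzero q fun hmem => hq' ⟨_, hmem, rfl⟩

theorem eq_zero_of_forall_isTest {f : SL2 n}
    (h : ∀ φ (hφ : IsTest φ), inner ℂ (cls φ hφ.continuous) f = 0) : f = 0 := by
  have hint : IntegrableOn f (fundDomain n) volume := (Lp.memLp f).integrable (by norm_num)
  have key : ∀ᵐ p ∂(volume : Measure (Heis n)), p ∈ openCube n → f p = 0 := by
    refine isOpen_openCube.ae_eq_zero_of_integral_contDiff_smul_eq_zero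
      (hint.mono_set openCube_subset).locallyIntegrableOn fun g hg hc hs => ?_
    have h1 := h _ (isTest_periodization hg hc hs)
    rw [inner_cls] at h1
    unfold quotMeasure at h1
    rw [← h1, ← setIntegral_eq_integral_of_forall_compl_eq_zero (s := fundDomain n)]
    · refine setIntegral_congr_fun measurableSet_fundDomain fun p hp => ?_
      simp only [red_eq_self hp, Complex.real_smul, Complex.conj_ofReal]
      rfl
    · intro p hp
      rw [image_eq_zero_of_notMem_tsupport fun hmem => hp (openCube_subset (hs hmem)), zero_smul]
  refine Lp.ext ?_
  have h2 : ∀ᵐ p ∂quotMeasure n, p ∈ openCube n := by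
    rw [quotMeasure, ← Measure.restrict_congr_set openCube_ae_eq]
    exact ae_restrict_mem isOpen_openCube.measurableSet
  filter_upwards [ae_restrict_of_ae (s := fundDomain n) key, h2,
    Lp.coeFn_zero ℂ 2 (quotMeasure n)] with p hp hp2 hp3
  rw [hp hp2, hp3, Pi.zero_apply]

/-! ### Strong continuity -/

theorem tendsto_U_cls {φ : Heis n → ℂ} (hφ : IsTest φ) :
    Tendsto (fun g => U g (cls φ hφ.continuous)) (𝓝 0) (𝓝 (cls φ hφ.continuous)) := by
  rw [Metric.tendsto_nhds]
  intro ε hε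
  have h1 : ∀ᶠ g in 𝓝 (0 : Heis n), ∀ p ∈ Set.Icc (0 : Heis n) 1,
      ‖φ (mul p g) - φ p‖ < ε / 2 := by
    refine isCompact_Icc.eventually_forall_of_forall_eventually fun p _ => ?_
    have hc : Continuous fun z : Heis n × Heis n => ‖φ (mul z.2 z.1) - φ z.2‖ :=
      ((hφ.continuous.comp (continuous_mul' continuous_snd continuous_fst)).sub
        (hφ.continuous.comp continuous_snd)).norm
    have := hc.tendsto (0, p)
    simp only [mul_zero', sub_self, norm_zero] at this
    exact this.eventually (gt_mem_nhds (half_pos hε))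
  filter_upwards [h1] with g hg
  rw [U_cls _ hφ.periodic, dist_eq_norm]
  refine lt_of_le_of_lt ?_ (half_lt_self hε)
  refine (Lp.norm_le_of_ae_bound (C := ε / 2) (half_pos hε).le ?_).trans ?_
  · filter_upwards [Lp.coeFn_sub (cls _ (isTest_comp_mul hφ g).continuous) (cls φ hφ.continuous),
      coeFn_cls hφ.continuous, coeFn_cls (isTest_comp_mul hφ g).continuous, ae_mem_fundDomain]
      with p h2 h3 h4 hp
    rw [h2, Pi.sub_apply, h3, h4]
    exact (hg p ⟨⟨fun i => (hp.1 i).1, fun β => (hp.2 β).1⟩,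
      ⟨fun i => (hp.1 i).2.le, fun β => (hp.2 β).2.le⟩⟩).le
  · simp [measureUnivNNReal]

/-- The vectors with this property form a subspace. It is closed because the operators are
isometries, and it is dense because it contains all test functions. -/
theorem tendsto_U_zero (f : SL2 n) : Tendsto (fun g => U g f) (𝓝 0) (𝓝 f) := by
  let S : Submodule ℂ (SL2 n) :=
    { carrier := {f | Tendsto (fun g => U g f) (𝓝 0) (𝓝 f)}
      zero_mem' := by simp
      add_mem' := fun {a b} ha hb => by
        simpa only [Set.mem_ofPred_eq, map_add] using Tendsto.add ha hb
      smul_mem' := fun c a ha => by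
        simpa only [Set.mem_ofPred_eq, map_smul] using Tendsto.const_smul ha c }
  have hclosed : IsClosed (S : Set (SL2 n)) := by
    rw [← closure_subset_iff_isClosed]
    intro f hf
    rw [Metric.mem_closure_iff] at hf
    change Tendsto _ _ _
    rw [Metric.tendsto_nhds]
    intro ε hε
    obtain ⟨a, ha, hd⟩ := hf (ε / 3) (by positivity)
    filter_upwards [Metric.tendsto_nhds.1 (show Tendsto (fun g => U g a) (𝓝 0) (𝓝 a) from ha)
      (ε / 3) (by positivity)] with g hg
    have h1 : dist (U g f) (U g a) < ε / 3 := by rwa [(U g).isometry.dist_eq]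
    have h2 := dist_triangle4 (U g f) (U g a) a f
    rw [dist_comm a f] at h2
    linarith
  have horth : Sᗮ = ⊥ := by
    rw [eq_bot_iff]
    intro f hf
    exact eq_zero_of_forall_isTest fun φ hφ => (Submodule.mem_orthogonal _ _).1 hf _
      (tendsto_U_cls hφ)
  have htop : S = ⊤ := by
    rw [← hclosed.submodule_topologicalClosure_eq, Submodule.topologicalClosure_eq_top_iff, horth]
  have : f ∈ S := htop ▸ Submodule.mem_top
  exact this

theorem continuous_U (f : SL2 n) : Continuous fun g => U g f := by
  rw [continuous_iff_continuousAt]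
  intro g
  have h1 : (fun h => U h f) = fun h => U g (U (mul (-g) h) f) := by
    funext h
    rw [← U_mul, ← mul_assoc', mul_neg_self, zero_mul']
  rw [ContinuousAt, h1]
  have h2 : Tendsto (fun h => mul (-g) h) (𝓝 g) (𝓝 0) := by
    simpa using (continuous_mul' continuous_const continuous_id).tendsto g (f := fun h => mul (-g) h)
  have h3 := ((U g).continuous.tendsto _).comp ((tendsto_U_zero f).comp h2)
  exact h3

/-! ### The mean value over the group -/

/-- As a double integral this is the integral of conj f(p) f(red(pg)). The map sending (p, g) to (p,
red(pg)) preserves the product measure, so the variables separate and the value is |∫ f|². -/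
theorem integral_inner_U {f : SL2 n} (hf : ∫ p, f p ∂quotMeasure n = 0) :
    ∫ g, inner ℂ f (U g f) ∂quotMeasure n = 0 := by
  set μ := quotMeasure n
  have hint : Integrable f μ := (Lp.memLp f).integrable (by norm_num)
  let G : Heis n × Heis n → ℂ := fun z => conj (f z.1) * f z.2
  have hG : Integrable G (μ.prod μ) :=
    (Integrable.mul_prod (f := fun p => conj (f p)) ((RCLike.conjCLE (K := ℂ)).toContinuousLinearMap.integrable_comp hint) hint)
  have hΦ : MeasurePreserving (fun z : Heis n × Heis n => (z.1, red (mul z.1 z.2)))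
      (μ.prod μ) (μ.prod μ) :=
    (MeasurePreserving.id μ).skew_product (g := fun p q => red (mul p q))
      (measurable_red.comp (measurable_mul' measurable_fst measurable_snd))
      (Eventually.of_forall fun p => (measurePreserving_red_mul_left p).map_eq)
  have h1 : ∫ z, G (z.1, red (mul z.1 z.2)) ∂μ.prod μ = 0 := by
    have h2 := integral_map hΦ.measurable.aemeasurable (f := G)
      (by rw [hΦ.map_eq]; exact hG.aestronglyMeasurable)
    rw [← h2, hΦ.map_eq]
    have := integral_prod_mul (μ := μ) (ν := μ) (fun p => conj (f p)) (fun p => f p)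
    rw [hf, mul_zero] at this
    exact this
  rw [integral_prod_symm (fun z => G (z.1, red (mul z.1 z.2)))
    (hΦ.integrable_comp_of_integrable hG)] at h1
  rw [← h1]
  refine integral_congr_ae (Eventually.of_forall fun g => ?_)
  simp only [L2.inner_def]
  refine integral_congr_ae ?_
  filter_upwards [coeFn_U g f] with p hp
  rw [hp, RCLike.inner_apply, mul_comm]

end TangentialCF

namespace TangentialCF
open Filter Topology ComplexConjugate

variable {n : ℕ}

/-! ### Invariant vector fields -/

/-- The linear part of the right invariant vector field with value `ξ` at the origin. -/
noncomputable def omegaMap (ξ : Heis n) : Heis n →L[ℝ] Heis n :=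
  LinearMap.toContinuousLinearMap
    { toFun := fun g => (0, fun β => 2 * omega β ξ.1 g.1)
      map_add' := fun g h => by
        refine Prod.ext (by simp) (funext fun β => ?_)
        simp [omega_add_right, mul_add]
      map_smul' := fun c g => by
        refine Prod.ext (by simp) (funext fun β => ?_)
        simp [omega_smul_right]
        ring }

theorem omegaMap_apply (ξ g : Heis n) : omegaMap ξ g = (0, fun β => 2 * omega β ξ.1 g.1) := rfl

section fields
variable {F : Type*} [NormedAddCommGroup F] [NormedSpace ℝ F]

/-- Minus the derivative along the right invariant vector field with value `ξ` at the origin. -/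
noncomputable def DR (ξ : Heis n) (ψ : Heis n → F) (g : Heis n) : F :=
  -fderiv ℝ ψ g (ξ + omegaMap ξ g)

/-- The derivative along the left invariant vector field with value `ξ` at the origin. -/
noncomputable def DL (ξ : Heis n) (ψ : Heis n → F) (g : Heis n) : F :=
  fderiv ℝ ψ g (ξ - omegaMap ξ g)

theorem mul_neg_smul_left (ξ g : Heis n) (τ : ℝ) :
    mul (-(τ • ξ)) g = g + τ • -(ξ + omegaMap ξ g) := by
  refine Prod.ext ?_ (funext fun β => ?_)
  · simp [mul_eq, omegaMap_apply, add_comm]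
  · simp [mul_eq, omegaMap_apply, omega_neg_left, omega_smul_left]
    ring

theorem mul_smul_right (ξ g : Heis n) (τ : ℝ) :
    mul g (τ • ξ) = g + τ • (ξ - omegaMap ξ g) := by
  refine Prod.ext ?_ (funext fun β => ?_)
  · simp [mul_eq, omegaMap_apply]
  · simp [mul_eq, omegaMap_apply, omega_smul_right, omega_swap β g.1 ξ.1]
    ring

/-- Moving ξ past h is the adjoint action: at the point ph one gets the left invariant field of ξ
plus a central correction depending only on h. -/
theorem mul_smul_mul (ξ p h : Heis n) (τ : ℝ) :
    mul (mul p (τ • ξ)) h = mul p h + τ • (ξ - omegaMap ξ (mul p h) + 2 • omegaMap ξ h) := by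
  refine Prod.ext ?_ (funext fun β => ?_)
  · simp [mul_eq, omegaMap_apply]
    abel
  · simp [mul_eq, omegaMap_apply, omega_smul_right, omega_smul_left, omega_swap β p.1 ξ.1,
      omega_add_left, omega_add_right]
    ring

theorem hasDerivAt_add_smul {ψ : Heis n → F} (hψ : ContDiff ℝ ∞ ψ) (g w : Heis n) (τ : ℝ) :
    HasDerivAt (fun τ : ℝ => ψ (g + τ • w)) (fderiv ℝ ψ (g + τ • w) w) τ := by
  have h1 : HasDerivAt (fun τ : ℝ => g + τ • w) w τ := by
    simpa using ((hasDerivAt_id τ).smul_const w).const_add g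
  exact ((hψ.differentiable (by simp)) _).hasFDerivAt.comp_hasDerivAt τ h1

theorem hasDerivAt_mul_left {ψ : Heis n → F} (hψ : ContDiff ℝ ∞ ψ) (ξ g : Heis n) (τ : ℝ) :
    HasDerivAt (fun τ : ℝ => ψ (mul (-(τ • ξ)) g)) (DR ξ ψ (mul (-(τ • ξ)) g)) τ := by
  have h := hasDerivAt_add_smul hψ g (-(ξ + omegaMap ξ g)) τ
  have e : ξ + omegaMap ξ (mul (-(τ • ξ)) g) = ξ + omegaMap ξ g := by
    refine Prod.ext rfl (funext fun β => ?_)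
    simp [mul_eq, omegaMap_apply, omega_add_right, omega_neg_right, omega_smul_right]
  rw [mul_neg_smul_left] at e
  simp only [DR, mul_neg_smul_left, e]
  rw [← map_neg]
  exact h

theorem hasDerivAt_mul_right {ψ : Heis n → F} (hψ : ContDiff ℝ ∞ ψ) (ξ g : Heis n) (τ : ℝ) :
    HasDerivAt (fun τ : ℝ => ψ (mul g (τ • ξ))) (DL ξ ψ (mul g (τ • ξ))) τ := by
  have h := hasDerivAt_add_smul hψ g (ξ - omegaMap ξ g) τ
  have e : ξ - omegaMap ξ (mul g (τ • ξ)) = ξ - omegaMap ξ g := by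
    refine Prod.ext rfl (funext fun β => ?_)
    simp [mul_eq, omegaMap_apply, omega_add_right, omega_smul_right]
  rw [mul_smul_right] at e
  simp only [DL, mul_smul_right, e]
  exact h

theorem contDiff_DR {ψ : Heis n → F} (hψ : ContDiff ℝ ∞ ψ) (ξ : Heis n) :
    ContDiff ℝ ∞ (DR ξ ψ) :=
  ((hψ.fderiv_right (m := ∞) (by simp)).clm_apply
    (contDiff_const.add (omegaMap ξ).contDiff)).neg

theorem contDiff_DL {ψ : Heis n → F} (hψ : ContDiff ℝ ∞ ψ) (ξ : Heis n) :
    ContDiff ℝ ∞ (DL ξ ψ) :=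
  (hψ.fderiv_right (m := ∞) (by simp)).clm_apply (contDiff_const.sub (omegaMap ξ).contDiff)

theorem DR_add_dir (ξ η : Heis n) (ψ : Heis n → F) (g : Heis n) :
    DR (ξ + η) ψ g = DR ξ ψ g + DR η ψ g := by
  have : ξ + η + omegaMap (ξ + η) g = (ξ + omegaMap ξ g) + (η + omegaMap η g) := by
    refine Prod.ext (by simp [omegaMap_apply]) (funext fun β => ?_)
    simp [omegaMap_apply, omega_add_left]
    ring
  rw [DR, this, map_add, neg_add, DR, DR]

theorem DR_smul_dir (c : ℝ) (ξ : Heis n) (ψ : Heis n → F) (g : Heis n) :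
    DR (c • ξ) ψ g = c • DR ξ ψ g := by
  have : c • ξ + omegaMap (c • ξ) g = c • (ξ + omegaMap ξ g) := by
    refine Prod.ext (by simp [omegaMap_apply]) (funext fun β => ?_)
    simp [omegaMap_apply, omega_smul_left]
    ring
  rw [DR, this, map_smul, DR, smul_neg]

/-- In the commutator the second derivatives cancel by symmetry. What remains comes from the linear
part of the fields and is central, so the operators `DR` represent the Lie algebra with bracket 4ω.
-/
theorem DR_comm {ψ : Heis n → F} (hψ : ContDiff ℝ ∞ ψ) (ξ η g : Heis n) :
    DR ξ (DR η ψ) g - DR η (DR ξ ψ) g = DR (2 • omegaMap ξ η) ψ g := by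
  have hd : DifferentiableAt ℝ (fderiv ℝ ψ) g :=
    (hψ.fderiv_right (m := ∞) (by simp)).differentiable (by simp) g
  have h : ∀ η w : Heis n, fderiv ℝ (DR η ψ) g w =
      -(fderiv ℝ (fderiv ℝ ψ) g w (η + omegaMap η g) + fderiv ℝ ψ g (omegaMap η w)) := by
    intro η w
    have h1 := hd.hasFDerivAt.clm_apply ((omegaMap η).hasFDerivAt (x := g).const_add η)
    have h2 : HasFDerivAt (DR η ψ) _ g := h1.neg
    rw [h2.fderiv, add_comm]
    rfl
  have hsymm : IsSymmSndFDerivAt ℝ ψ g := 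
    hψ.contDiffAt.isSymmSndFDerivAt (by simp; exact WithTop.coe_le_coe.2 (le_top : (2 : ℕ∞) ≤ ⊤))
  rw [DR, DR, h, h, hsymm.eq (ξ + omegaMap ξ g) (η + omegaMap η g)]
  have e1 : omegaMap (2 • omegaMap ξ η) g = 0 := by
    refine Prod.ext rfl (funext fun β => ?_)
    simp [omegaMap_apply]
  have e2 : (2 : ℕ) • omegaMap ξ η = omegaMap ξ (η + omegaMap η g) -
      omegaMap η (ξ + omegaMap ξ g) := by
    refine Prod.ext (by simp [omegaMap_apply]) (funext fun β => ?_)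
    simp [omegaMap_apply, omega_swap β ξ.1 η.1]
    ring
  rw [DR, e1, add_zero, e2, map_sub]
  abel

end fields

/-! ### Mollification -/

/-- Smooth compactly supported functions on the group. -/
structure IsBump (ψ : Heis n → ℝ) : Prop where
  smooth : ContDiff ℝ ∞ ψ
  support : HasCompactSupport ψ

theorem IsBump.DR {ψ : Heis n → ℝ} (hψ : IsBump ψ) (ξ : Heis n) : IsBump (DR ξ ψ) :=
  ⟨contDiff_DR hψ.smooth ξ, (hψ.support.fderiv ℝ).mono' fun g hg => subset_tsupport _ fun h =>
    hg (by simp [TangentialCF.DR, h])⟩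

theorem IsBump.mul_left {ψ c : Heis n → ℝ} (hψ : IsBump ψ) (hc : ContDiff ℝ ∞ c) :
    IsBump fun g => c g * ψ g :=
  ⟨hc.mul hψ.smooth, hψ.support.mul_left⟩

/-- The mollification `∫ ψ(g) U(g) f dg` of a square integrable function. -/
noncomputable def moll (ψ : Heis n → ℝ) (f : SL2 n) : SL2 n := ∫ g, ψ g • U g f

theorem IsBump.integrable_smul {ψ : Heis n → ℝ} (hψ : IsBump ψ) {F : Type*}
    [NormedAddCommGroup F] [NormedSpace ℝ F] {h : Heis n → F} (hh : Continuous h) :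
    Integrable fun g => ψ g • h g :=
  (hψ.smooth.continuous.smul hh).integrable_of_hasCompactSupport hψ.support.smul_right

theorem inner_moll {ψ : Heis n → ℝ} (hψ : IsBump ψ) (h f : SL2 n) :
    inner ℂ h (moll ψ f) = ∫ g, ψ g • inner ℂ h (U g f) := by
  have := ((innerSL ℂ h).restrictScalars ℝ).integral_comp_comm
    (hψ.integrable_smul (continuous_U f))
  simp only [ContinuousLinearMap.coe_restrictScalars', innerSL_apply_apply] at this
  rw [moll, ← this]
  refine integral_congr_ae (Eventually.of_forall fun g => ?_)
  exact inner_smul_right_eq_smul h (U g f) (ψ g)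

theorem moll_add {ψ χ : Heis n → ℝ} (hψ : IsBump ψ) (hχ : IsBump χ) (f : SL2 n) :
    moll (fun g => ψ g + χ g) f = moll ψ f + moll χ f := by
  simp only [moll, add_smul]
  exact integral_add (hψ.integrable_smul (continuous_U f)) (hχ.integrable_smul (continuous_U f))

theorem moll_smul (c : ℝ) (ψ : Heis n → ℝ) (f : SL2 n) :
    moll (fun g => c * ψ g) f = c • moll ψ f := by
  simp only [moll, mul_smul, integral_smul]

theorem moll_neg (ψ : Heis n → ℝ) (f : SL2 n) :
    moll (fun g => -ψ g) f = -moll ψ f := by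
  simp only [moll, neg_smul, integral_neg]

theorem moll_sub {ψ χ : Heis n → ℝ} (hψ : IsBump ψ) (hχ : IsBump χ) (f : SL2 n) :
    moll (fun g => ψ g - χ g) f = moll ψ f - moll χ f := by
  simp only [moll, sub_smul]
  exact integral_sub (hψ.integrable_smul (continuous_U f)) (hχ.integrable_smul (continuous_U f))

theorem U_moll {ψ : Heis n → ℝ} (hψ : IsBump ψ) (h : Heis n) (f : SL2 n) :
    U h (moll ψ f) = ∫ g, ψ (mul (-h) g) • U g f := by
  have h1 := ((U h).toContinuousLinearMap.restrictScalars ℝ).integral_comp_comm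
    (hψ.integrable_smul (continuous_U f))
  have h2 := measurePreserving_mul_left h
  have hc : Continuous fun g => ψ (mul (-h) g) • U g f :=
    (hψ.smooth.continuous.comp (continuous_mul' continuous_const continuous_id)).smul
      (continuous_U f)
  have h3 := integral_map (μ := volume) h2.measurable.aemeasurable (f := fun g => ψ (mul (-h) g) • U g f)
    hc.aestronglyMeasurable
  rw [h2.map_eq] at h3
  rw [h3, moll]
  refine h1.symm.trans (integral_congr_ae (Eventually.of_forall fun g => ?_))
  simp only [← mul_assoc', neg_mul_self, zero_mul', U_mul]
  exact map_smul ((U h).toContinuousLinearMap.restrictScalars ℝ) _ _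

/-- `f'` is the derivative of `f` in the direction `ξ`, as a derivative in `L²`. -/
def HasGen (ξ : Heis n) (f f' : SL2 n) : Prop :=
  HasDerivAt (fun τ : ℝ => U (τ • ξ) f) f' 0

/-- Left invariance of Lebesgue measure moves the translation from the vector to the kernel, where
it can be differentiated under the integral. Every mollification is thus a smooth vector, its
derivative being a mollification again. -/
theorem hasGen_moll {ψ : Heis n → ℝ} (hψ : IsBump ψ) (ξ : Heis n) (f : SL2 n) :
    HasGen ξ (moll ψ f) (moll (DR ξ ψ) f) := by
  unfold HasGen
  simp only [U_moll hψ]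
  have hb := hψ.DR ξ
  obtain ⟨M, hM⟩ := hb.support.exists_bound_of_continuous hb.smooth.continuous
  -- K is compact and carries the differentiated integrand for all |τ| ≤ 1, which provides an
  -- integrable dominating function.
  let K : Set (Heis n) := (fun z : ℝ × Heis n => mul (z.1 • ξ) z.2) ''
    (Set.Icc (-1) 1 ×ˢ tsupport (DR ξ ψ))
  have hK : IsCompact K := by
    refine (isCompact_Icc.prod hb.support.isCompact).image ?_
    exact continuous_mul' (continuous_fst.smul continuous_const) continuous_snd
  have hcont : ∀ (χ : Heis n → ℝ), Continuous χ → ∀ τ : ℝ,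
      Continuous fun g => χ (mul (-(τ • ξ)) g) • U g f := fun χ hχ τ =>
    (hχ.comp (continuous_mul' continuous_const continuous_id)).smul (continuous_U f)
  have key := hasDerivAt_integral_of_dominated_loc_of_deriv_le (μ := (volume : Measure (Heis n)))
    (F := fun (τ : ℝ) g => ψ (mul (-(τ • ξ)) g) • U g f)
    (F' := fun τ g => DR ξ ψ (mul (-(τ • ξ)) g) • U g f) (x₀ := 0)
    (bound := K.indicator fun _ => M * ‖f‖) (Metric.ball_mem_nhds 0 one_pos)
    (Eventually.of_forall fun τ => (hcont _ hψ.smooth.continuous τ).aestronglyMeasurable)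
    (by simpa using hψ.integrable_smul (continuous_U f))
    (hcont _ hb.smooth.continuous 0).aestronglyMeasurable
    (Eventually.of_forall fun g τ hτ => ?_)
    ((integrable_indicator_iff hK.measurableSet).2 (integrableOn_const hK.measure_lt_top.ne))
    (Eventually.of_forall fun g τ _ =>
      (hasDerivAt_mul_left hψ.smooth ξ g τ).smul_const (U g f))
  · simpa [moll] using key.2
  · by_cases hg : g ∈ K
    · rw [Set.indicator_of_mem hg, norm_smul, (U g).norm_map]
      exact mul_le_mul_of_nonneg_right (hM _) (norm_nonneg _)
    · rw [Set.indicator_of_notMem hg,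
        image_eq_zero_of_notMem_tsupport (f := DR ξ ψ) (x := mul (-(τ • ξ)) g), zero_smul,
        norm_zero]
      refine fun hmem => hg ⟨(τ, mul (-(τ • ξ)) g), ⟨?_, hmem⟩, ?_⟩
      · rw [Metric.mem_ball, dist_zero_right, Real.norm_eq_abs] at hτ
        exact abs_le.1 hτ.le
      · simp [← mul_assoc']

/-- Differentiating the constant function ⟨U(τξ)f, U(τξ)g⟩ at 0 shows that generators of unitary
groups are skew. -/
theorem HasGen.inner_left {ξ : Heis n} {f f' g g' : SL2 n} (hf : HasGen ξ f f')
    (hg : HasGen ξ g g') : inner ℂ f' g = -inner ℂ f g' := by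
  have h1 := HasDerivAt.inner ℂ hf hg
  have h2 : (fun τ : ℝ => inner ℂ (U (τ • ξ) f) (U (τ • ξ) g)) = fun _ => inner ℂ f g := by
    funext τ; exact (U (τ • ξ)).inner_map_map f g
  rw [h2] at h1
  have h3 := h1.unique (hasDerivAt_const 0 _)
  simp only [zero_smul, U_zero] at h3
  linear_combination h3

/-- The orbit of f along the one-parameter group has velocity U(τξ)f', of constant norm ‖f'‖, so the
mean value inequality on [0, 1] applies. -/
theorem HasGen.norm_U_sub_le {ξ : Heis n} {f f' : SL2 n} (hf : HasGen ξ f f') :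
    ‖U ξ f - f‖ ≤ ‖f'‖ := by
  have hd : ∀ τ : ℝ, HasDerivAt (fun τ : ℝ => U (τ • ξ) f) (U (τ • ξ) f') τ := by
    intro τ
    have h1 : (fun s : ℝ => U (s • ξ) f) = fun s => U (τ • ξ) (U ((s - τ) • ξ) f) := by
      funext s
      rw [← U_mul, smul_mul_smul, add_sub_cancel]
    rw [h1]
    have h2 : HasDerivAt (fun s : ℝ => U ((s - τ) • ξ) f) f' τ := by
      have h3 : HasDerivAt (fun s : ℝ => U (s • ξ) f) f' (τ - τ) := by rw [sub_self]; exact hf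
      simpa using h3.comp_sub_const τ τ
    exact ((U (τ • ξ)).toContinuousLinearMap.restrictScalars ℝ).hasFDerivAt.comp_hasDerivAt τ h2
  have := Convex.norm_image_sub_le_of_norm_hasDerivWithin_le (C := ‖f'‖) (s := Set.univ)
    (fun τ _ => (hd τ).hasDerivWithinAt) (fun τ _ => ((U (τ • ξ)).norm_map f').le)
    convex_univ (Set.mem_univ 0) (Set.mem_univ 1)
  simpa using this

/-- The derivatives of a mollification, as a linear function of the direction. -/
noncomputable def gen {ψ : Heis n → ℝ} (hψ : IsBump ψ) (f : SL2 n) : Heis n →ₗ[ℝ] SL2 n where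
  toFun ξ := moll (DR ξ ψ) f
  map_add' ξ η := by
    rw [← moll_add (hψ.DR ξ) (hψ.DR η)]
    congr 1
    funext g
    exact DR_add_dir ξ η ψ g
  map_smul' c ξ := by
    rw [RingHom.id_apply, ← moll_smul]
    congr 1
    funext g
    exact DR_smul_dir c ξ ψ g

theorem gen_apply {ψ : Heis n → ℝ} (hψ : IsBump ψ) (f : SL2 n) (ξ : Heis n) :
    gen hψ f ξ = moll (DR ξ ψ) f := rfl

theorem hasGen_gen {ψ : Heis n → ℝ} (hψ : IsBump ψ) (f : SL2 n) (ξ : Heis n) :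
    HasGen ξ (moll ψ f) (gen hψ f ξ) := hasGen_moll hψ ξ f

/-- Skewness puts both derivatives on the left factor, where their difference is a commutator. This
is the only way in which noncommutativity enters the energy estimates. -/
theorem inner_gen_gen_sub {ψ : Heis n → ℝ} (hψ : IsBump ψ) (f g : SL2 n) (ξ η : Heis n) :
    inner ℂ (gen hψ f ξ) (gen hψ g η) - inner ℂ (gen hψ f η) (gen hψ g ξ) =
      inner ℂ (gen hψ f (2 • omegaMap ξ η)) (moll ψ g) := by
  have h1 : ∀ ξ η, inner ℂ (gen hψ f ξ) (gen hψ g η) =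
      -inner ℂ (moll (DR η (DR ξ ψ)) f) (moll ψ g) := fun ξ η => by
    rw [(hasGen_moll (hψ.DR ξ) η f).inner_left (hasGen_gen hψ g η), neg_neg, gen_apply]
  have h2 : gen hψ f (2 • omegaMap ξ η) =
      moll (DR ξ (DR η ψ)) f - moll (DR η (DR ξ ψ)) f := by
    rw [← moll_sub ((hψ.DR _).DR _) ((hψ.DR _).DR _), gen_apply]
    congr 1
    funext g
    exact (DR_comm hψ.smooth ξ η g).symm
  rw [h1, h1, h2, inner_sub_left]
  ring

end TangentialCF

namespace TangentialCF
open Filter Topology ComplexConjugate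

variable {n : ℕ}

/-! ### Duality with test functions -/

theorem isTest_DL {φ : Heis n → ℂ} (hφ : IsTest φ) (ξ : Heis n) : IsTest (DL ξ φ) := by
  refine ⟨contDiff_DL hφ.smooth ξ, fun a m p => ?_⟩
  have h1 := hasDerivAt_mul_right hφ.smooth ξ (mul (latticePoint a m) p) 0
  have h2 := hasDerivAt_mul_right hφ.smooth ξ p 0
  have hper : ∀ q, φ (mul (latticePoint a m) q) = φ q := hφ.periodic a m
  simp only [mul_assoc', hper] at h1
  simpa using h1.unique h2

theorem Y_eq_DL (i : Fin n × Fin 4) {φ : Heis n → ℂ} (hφ : ContDiff ℝ ∞ φ) :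
    Y i φ = DL (Pi.single i 1, 0) φ := by
  funext p
  have h := hasDerivAt_mul_right hφ (Pi.single i 1, 0) p 0
  have e : ∀ t : ℝ, ((Pi.single i t, 0) : Heis n) = t • (Pi.single i 1, 0) := fun t => by
    refine Prod.ext ?_ (by simp)
    rw [Prod.smul_fst, ← Pi.single_smul, smul_eq_mul, mul_one]
  have h' := h.deriv
  rw [zero_smul, mul_zero'] at h'
  rw [← h', Y]
  congr 1
  funext t
  rw [e t]

theorem IsTest.exists_bound {φ : Heis n → ℂ} (hφ : IsTest φ) : ∃ M, ∀ p, ‖φ p‖ ≤ M := by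
  obtain ⟨M, hM⟩ := exists_bound_fundDomain hφ.continuous
  exact ⟨M, fun p => by rw [← hφ.periodic.red p]; exact hM _ (red_mem p)⟩

theorem hasDerivAt_integral_mul_right {φ : Heis n → ℂ} (hφ : IsTest φ) (ξ : Heis n) {f : Heis n → ℂ}
    (hf : Integrable f (quotMeasure n)) :
    HasDerivAt (fun τ : ℝ => ∫ p, φ (mul p (τ • ξ)) * f p ∂quotMeasure n)
      (∫ p, DL ξ φ p * f p ∂quotMeasure n) 0 := by
  obtain ⟨M, hM⟩ := (isTest_DL hφ ξ).exists_bound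
  obtain ⟨M', hM'⟩ := hφ.exists_bound
  have hc : ∀ τ : ℝ, Continuous fun p : Heis n => mul p (τ • ξ) := fun τ =>
    continuous_mul' continuous_id continuous_const
  have key := hasDerivAt_integral_of_dominated_loc_of_deriv_le (μ := quotMeasure n)
    (F := fun (τ : ℝ) p => φ (mul p (τ • ξ)) * f p)
    (F' := fun τ p => DL ξ φ (mul p (τ • ξ)) * f p) (x₀ := 0)
    (bound := fun p => M * ‖f p‖) (Metric.ball_mem_nhds 0 one_pos)
    (Eventually.of_forall fun τ =>
      (hφ.continuous.comp (hc τ)).aestronglyMeasurable.mul hf.aestronglyMeasurable)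
    (hf.bdd_mul (c := M') (hφ.continuous.comp (hc 0)).aestronglyMeasurable
      (Eventually.of_forall fun p => hM' _))
    (((isTest_DL hφ ξ).continuous.comp (hc 0)).aestronglyMeasurable.mul hf.aestronglyMeasurable)
    (Eventually.of_forall fun p τ _ => by
      rw [norm_mul]; exact mul_le_mul_of_nonneg_right (hM _) (norm_nonneg _))
    (hf.norm.const_mul M)
    (Eventually.of_forall fun p τ _ => (hasDerivAt_mul_right hφ.smooth ξ p τ).mul_const (f p))
  simpa using key.2

theorem integral_mul_right_eq {φ : Heis n → ℂ} (hφ : IsPeriodic φ) (hc : Continuous φ)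
    (g : Heis n) : ∫ p, φ (mul p g) ∂quotMeasure n = ∫ p, φ p ∂quotMeasure n := by
  have h := measurePreserving_red_mul_right g
  have h1 := integral_map (μ := quotMeasure n) h.measurable.aemeasurable (f := φ)
    hc.aestronglyMeasurable
  rw [h.map_eq] at h1
  simpa only [hφ.red] using h1.symm

theorem integral_DL_mul {φ χ : Heis n → ℂ} (hφ : IsTest φ) (hχ : IsTest χ) (ξ : Heis n) :
    ∫ p, DL ξ φ p * χ p ∂quotMeasure n = -∫ p, φ p * DL ξ χ p ∂quotMeasure n := by
  have h1 := hasDerivAt_integral_mul_right (hφ.mul hχ) ξ (integrable_const (1 : ℂ))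
  have h2 : (fun τ : ℝ => ∫ p, φ (mul p (τ • ξ)) * χ (mul p (τ • ξ)) * (1 : ℂ) ∂quotMeasure n) =
      fun _ => ∫ p, φ p * χ p ∂quotMeasure n := by
    funext τ
    simp only [mul_one]
    exact integral_mul_right_eq (hφ.mul hχ).periodic (hφ.mul hχ).continuous _
  rw [h2] at h1
  have h3 := h1.unique (hasDerivAt_const 0 _)
  have h4 : ∀ p, DL ξ (fun p => φ p * χ p) p * 1 = DL ξ φ p * χ p + φ p * DL ξ χ p := by
    intro p
    have e := (hasDerivAt_mul_right hφ.smooth ξ p 0).mul (hasDerivAt_mul_right hχ.smooth ξ p 0)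
    have e' := hasDerivAt_mul_right (hφ.mul hχ).smooth ξ p 0
    simpa using e'.unique e
  simp only [h4] at h3
  have hint : ∀ {a b : Heis n → ℂ}, IsTest a → IsTest b →
      Integrable (fun p => a p * b p) (quotMeasure n) := fun ha hb =>
    (memLp_of_continuous (ha.mul hb).continuous).integrable (by norm_num)
  rw [integral_add (hint (isTest_DL hφ ξ) hχ) (hint hφ (isTest_DL hχ ξ))] at h3
  exact eq_neg_of_add_eq_zero_left h3

theorem DL_conj {φ : Heis n → ℂ} (hφ : IsTest φ) (ξ p : Heis n) :
    DL ξ (fun p => conj (φ p)) p = conj (DL ξ φ p) := by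
  have h1 := hasDerivAt_mul_right hφ.conj.smooth ξ p 0
  have h2 := (hasDerivAt_mul_right hφ.smooth ξ p 0).star
  have h3 : HasDerivAt (fun τ : ℝ => conj (φ (mul p (τ • ξ)))) _ 0 := h2
  simpa using h1.unique h3

theorem HasGen.inner_cls_DL {ξ : Heis n} {f f' : SL2 n} (hf : HasGen ξ f f') {φ : Heis n → ℂ}
    (hφ : IsTest φ) :
    inner ℂ (cls (DL ξ φ) (isTest_DL hφ ξ).continuous) f =
      -inner ℂ (cls φ hφ.continuous) f' := by
  have h1 := hasDerivAt_integral_mul_right hφ.conj ξ ((Lp.memLp f).integrable (by norm_num))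
  have h2 : (fun τ : ℝ => ∫ p, conj (φ (mul p (τ • ξ))) * f p ∂quotMeasure n) =
      fun τ => inner ℂ (cls φ hφ.continuous) (U ((-τ) • ξ) f) := by
    funext τ
    rw [neg_smul, ← inner_U_left, U_cls _ hφ.periodic]
    exact (inner_cls (isTest_comp_mul hφ (τ • ξ)).continuous f).symm
  have h3 : HasDerivAt (fun τ : ℝ => U ((-τ) • ξ) f) (-f') 0 := by
    have : HasDerivAt (fun τ : ℝ => U (τ • ξ) f) f' (-0) := by rw [neg_zero]; exact hf
    have h := this.scomp 0 (hasDerivAt_neg (0 : ℝ))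
    rw [neg_one_smul] at h
    exact h
  have h4 := HasDerivAt.inner ℂ (hasDerivAt_const (0 : ℝ) (cls φ hφ.continuous)) h3
  rw [h2] at h1
  have h5 := h1.unique h4
  simp only [inner_neg_right, inner_zero_left, add_zero] at h5
  rw [← h5, inner_cls]
  simp only [DL_conj hφ]

theorem DL_comp_mul {φ : Heis n → ℂ} (hφ : IsTest φ) (ξ h p : Heis n) :
    DL ξ (fun p => φ (mul p h)) p =
      DL ξ φ (mul p h) + ∑ β, ((4 * omega β ξ.1 h.1 : ℝ) : ℂ) *
        DL (0, Pi.single β 1) φ (mul p h) := by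
  have h1 := hasDerivAt_mul_right (isTest_comp_mul hφ h).smooth ξ p 0
  have h2 := hasDerivAt_add_smul hφ.smooth (mul p h)
    (ξ - omegaMap ξ (mul p h) + 2 • omegaMap ξ h) 0
  simp only [mul_smul_mul] at h1
  have h3 := h1.unique h2
  simp only [zero_smul, add_zero, mul_zero'] at h3
  rw [h3, map_add, DL]
  congr 1
  have e : (2 : ℕ) • omegaMap ξ h = ∑ β, (4 * omega β ξ.1 h.1) •
      ((0, Pi.single β 1) - omegaMap (0, Pi.single β 1) (mul p h) : Heis n) := by
    refine Prod.ext (funext fun i => ?_) (funext fun β => ?_)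
    · simp [omegaMap_apply, Prod.fst_sum]
    · simp [omegaMap_apply, Prod.snd_sum, Pi.single_apply]
      ring
  rw [e, map_sum]
  refine Finset.sum_congr rfl fun β _ => ?_
  rw [map_smul, Complex.real_smul, DL]

/-- The coefficient functions of the difference between the invariant vector fields. -/
noncomputable def shearCoeff (ξ : Heis n) (β : Fin 3) (g : Heis n) : ℝ := 4 * omega β g.1 ξ.1

theorem contDiff_shearCoeff (ξ : Heis n) (β : Fin 3) : ContDiff ℝ ∞ (shearCoeff ξ β) :=
  contDiff_const.mul (contDiff_omega β contDiff_fst contDiff_const)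

/-- The left and right invariant fields of ξ differ by central fields with coefficients linear in
the horizontal variables. Those coefficients are constant along the center, so they can be taken
inside the central derivative. -/
theorem DL_eq {ψ : Heis n → ℝ} (hψ : IsBump ψ) (ξ g : Heis n) :
    DL ξ ψ g = -DR ξ ψ g - ∑ β, DR (0, Pi.single β 1) (fun g => shearCoeff ξ β g * ψ g) g := by
  have h : ∀ β, DR (0, Pi.single β 1) (fun g => shearCoeff ξ β g * ψ g) g =
      -(shearCoeff ξ β g * fderiv ℝ ψ g (0, Pi.single β 1)) := by
    intro β
    have e1 : ((0, Pi.single β 1) : Heis n) + omegaMap (0, Pi.single β 1) g =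
        (0, Pi.single β 1) := by
      refine Prod.ext (by simp [omegaMap_apply]) (funext fun γ => ?_)
      simp [omegaMap_apply]
    have h1 := hasDerivAt_add_smul ((contDiff_shearCoeff ξ β).mul hψ.smooth) g
      (0, Pi.single β 1) 0
    have h2 := (hasDerivAt_add_smul hψ.smooth g (0, Pi.single β 1) 0).const_mul (shearCoeff ξ β g)
    have e2 : ∀ τ : ℝ, shearCoeff ξ β (g + τ • (0, Pi.single β 1)) = shearCoeff ξ β g := by
      intro τ; simp [shearCoeff]
    simp only [e2] at h1
    have h3 := h1.unique h2
    rw [zero_smul, add_zero] at h3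
    rw [DR, e1]
    exact congrArg Neg.neg h3
  simp only [h, Finset.sum_neg_distrib]
  have e : ξ - omegaMap ξ g = (ξ + omegaMap ξ g) +
      ∑ β, shearCoeff ξ β g • ((0, Pi.single β 1) : Heis n) := by
    refine Prod.ext (funext fun i => ?_) (funext fun β => ?_)
    · simp [omegaMap_apply, Prod.fst_sum]
    · simp [omegaMap_apply, Prod.snd_sum, Pi.single_apply, shearCoeff, omega_swap β ξ.1 g.1]
      ring
  rw [DL, e, map_add, map_sum, DR]
  simp only [map_smul, smul_eq_mul, sub_neg_eq_add, neg_neg]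

theorem moll_sum {ι : Type*} (s : Finset ι) {ψ : ι → Heis n → ℝ} (hψ : ∀ i, IsBump (ψ i))
    (f : SL2 n) : moll (fun g => ∑ i ∈ s, ψ i g) f = ∑ i ∈ s, moll (ψ i) f := by
  simp only [moll, Finset.sum_smul]
  exact integral_finsetSum _ fun i _ => (hψ i).integrable_smul (continuous_U f)

theorem moll_DL {ψ : Heis n → ℝ} (hψ : IsBump ψ) (ξ : Heis n) (f : SL2 n) :
    moll (DL ξ ψ) f = -moll (DR ξ ψ) f -
      ∑ β, moll (DR (0, Pi.single β 1) (fun g => shearCoeff ξ β g * ψ g)) f := by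
  rw [← moll_neg, ← moll_sum _ fun β => (hψ.mul_left (contDiff_shearCoeff ξ β)).DR _]
  have hb : IsBump fun g => ∑ β, DR (0, Pi.single β 1) (fun g => shearCoeff ξ β g * ψ g) g := by
    have hβ : ∀ β, IsBump (DR (0, Pi.single β 1) (fun g => shearCoeff ξ β g * ψ g)) := fun β =>
      (hψ.mul_left (contDiff_shearCoeff ξ β)).DR _
    refine ⟨ContDiff.sum fun β _ => (hβ β).smooth, ?_⟩
    simp only [Fin.sum_univ_three]
    exact ((hβ 0).support.add (hβ 1).support).add (hβ 2).support
  have hb' : IsBump fun g => -DR ξ ψ g := ⟨(hψ.DR ξ).smooth.neg, (hψ.DR ξ).support.neg⟩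
  rw [← moll_sub hb' hb]
  congr 1
  funext g
  exact DL_eq hψ ξ g

theorem integral_inner_translate {ψ : Heis n → ℝ} (hψ : IsBump ψ) {φ : Heis n → ℂ} (hφ : IsTest φ)
    (f : SL2 n) :
    ∫ g, ψ g • inner ℂ (cls _ (isTest_comp_mul hφ (-g)).continuous) f =
      inner ℂ (cls φ hφ.continuous) (moll ψ f) := by
  rw [inner_moll hψ]
  refine integral_congr_ae (Eventually.of_forall fun g => ?_)
  simp only
  rw [← neg_neg g, ← inner_U_left, U_cls _ hφ.periodic, neg_neg]

theorem inner_cls_DL_translate {φ : Heis n → ℂ} (hφ : IsTest φ) (ξ g : Heis n) (f : SL2 n) :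
    inner ℂ (cls _ (isTest_DL (isTest_comp_mul hφ (-g)) ξ).continuous) f =
      inner ℂ (cls _ (isTest_DL hφ ξ).continuous) (U g f) + ∑ β, (shearCoeff ξ β g : ℂ) *
        inner ℂ (cls _ (isTest_DL hφ (0, Pi.single β 1)).continuous) (U g f) := by
  have h : cls _ (isTest_DL (isTest_comp_mul hφ (-g)) ξ).continuous =
      U (-g) (cls _ (isTest_DL hφ ξ).continuous) + ∑ β, (shearCoeff ξ β g : ℂ) •
        U (-g) (cls _ (isTest_DL hφ (0, Pi.single β 1)).continuous) := by
    simp only [U_cls _ (isTest_DL hφ _).periodic]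
    refine Lp.ext ?_
    have hs : ∀ β, (((shearCoeff ξ β g : ℂ) • cls _ (isTest_comp_mul
        (isTest_DL hφ (0, Pi.single β 1)) (-g)).continuous : SL2 n) : Heis n → ℂ)
        =ᵐ[quotMeasure n] fun p => (shearCoeff ξ β g : ℂ) *
          DL (0, Pi.single β 1) φ (mul p (-g)) := by
      intro β
      filter_upwards [Lp.coeFn_smul (shearCoeff ξ β g : ℂ) (cls _ (isTest_comp_mul
        (isTest_DL hφ (0, Pi.single β 1)) (-g)).continuous), coeFn_cls (isTest_comp_mul
        (isTest_DL hφ (0, Pi.single β 1)) (-g)).continuous] with p h1 h2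
      rw [h1, Pi.smul_apply, h2, smul_eq_mul]
    simp only [Fin.sum_univ_three]
    refine (coeFn_cls _).trans (EventuallyEq.symm ((Lp.coeFn_add _ _).trans ?_))
    refine ((coeFn_cls _).add ((Lp.coeFn_add _ _).trans
      (((Lp.coeFn_add _ _).trans ((hs 0).add (hs 1))).add (hs 2)))).trans ?_
    refine Eventually.of_forall fun p => ?_
    simp only [Pi.add_apply]
    rw [DL_comp_mul hφ, Fin.sum_univ_three]
    simp only [shearCoeff, Prod.fst_neg, omega_neg_right, omega_swap _ ξ.1 g.1]
  rw [h, inner_add_left, sum_inner, inner_U_left, neg_neg]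
  simp only [inner_smul_left, inner_U_left, neg_neg, Complex.conj_ofReal]

theorem integrable_inner_cls_DL_translate {ψ : Heis n → ℝ} (hψ : IsBump ψ) {φ : Heis n → ℂ}
    (hφ : IsTest φ) (ξ : Heis n) (f : SL2 n) :
    Integrable fun g => ψ g • inner ℂ
      (cls _ (isTest_DL (isTest_comp_mul hφ (-g)) ξ).continuous) f := by
  refine hψ.integrable_smul ?_
  refine Continuous.congr ?_ fun g => (inner_cls_DL_translate hφ ξ g f).symm
  have hU := continuous_U f
  have hs := fun β => (contDiff_shearCoeff (n := n) ξ β).continuous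
  refine (continuous_const.inner hU).add (continuous_finsetSum _ fun β _ => ?_)
  exact (Complex.continuous_ofReal.comp (hs β)).mul (continuous_const.inner hU)

/-- Formally U(g)Yf is the derivative of U(·)f at g along the left invariant field of ξ. Integrating
it against ψ by parts puts that derivative on ψ, with a sign that cancels the one from moving Y off
the test function. Everything is paired with φ since Yf exists only as a distribution. -/
theorem integral_inner_cls_DL_translate {ψ : Heis n → ℝ} (hψ : IsBump ψ) {φ : Heis n → ℂ}
    (hφ : IsTest φ) (ξ : Heis n) (f : SL2 n) :
    ∫ g, ψ g • inner ℂ (cls _ (isTest_DL (isTest_comp_mul hφ (-g)) ξ).continuous) f =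
      inner ℂ (cls φ hφ.continuous) (moll (DL ξ ψ) f) := by
  have hU := continuous_U f
  have hs := fun β => hψ.mul_left (contDiff_shearCoeff ξ β)
  have hc : ∀ ξ, Continuous fun g =>
    inner ℂ (cls _ (isTest_DL hφ ξ).continuous) (U g f) := fun ξ => continuous_const.inner hU
  have e : ∀ g, ψ g • inner ℂ (cls _ (isTest_DL (isTest_comp_mul hφ (-g)) ξ).continuous) f =
      ψ g • inner ℂ (cls _ (isTest_DL hφ ξ).continuous) (U g f) +
      ∑ β, (shearCoeff ξ β g * ψ g) •
        inner ℂ (cls _ (isTest_DL hφ (0, Pi.single β 1)).continuous) (U g f) := by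
    intro g
    rw [inner_cls_DL_translate hφ, smul_add, Finset.smul_sum]
    congr 1
    refine Finset.sum_congr rfl fun β _ => ?_
    simp only [Complex.real_smul, Complex.ofReal_mul]
    ring
  simp only [e]
  rw [integral_add (hψ.integrable_smul (hc _))
    (integrable_finsetSum _ fun β _ => (hs β).integrable_smul (hc _)),
    integral_finsetSum _ fun β _ => (hs β).integrable_smul (hc _), ← inner_moll hψ]
  simp only [← inner_moll (hs _)]
  rw [(hasGen_moll hψ ξ f).inner_cls_DL hφ, moll_DL hψ, inner_sub_right, inner_sum,
    inner_neg_right, sub_eq_add_neg, ← Finset.sum_neg_distrib]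
  congr 1
  refine Finset.sum_congr rfl fun β _ => ?_
  rw [(hasGen_moll (hs β) _ f).inner_cls_DL hφ]

/-- A first order relation which holds in the sense of distributions holds, up to commutator terms,
for mollifications. -/
theorem sum_smul_gen_eq {ι : Type*} (s : Finset ι) (c : ι → ℂ) (ξ : ι → Heis n) (F : ι → SL2 n)
    (v : SL2 n)
    (h : ∀ φ (hφ : IsTest φ), ∑ i ∈ s, c i * inner ℂ
      (cls _ (isTest_DL hφ (ξ i)).continuous) (F i) = -inner ℂ (cls φ hφ.continuous) v)
    {ψ : Heis n → ℝ} (hψ : IsBump ψ) :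
    ∑ i ∈ s, c i • gen hψ (F i) (ξ i) = moll ψ v - ∑ i ∈ s, c i • ∑ β,
      moll (DR (0, Pi.single β 1) (fun g => shearCoeff (ξ i) β g * ψ g)) (F i) := by
  -- The hypothesis is applied to all right translates of φ and integrated against ψ; test functions
  -- then detect the resulting identity in L².
  have key : ∑ i ∈ s, c i • moll (DL (ξ i) ψ) (F i) + moll ψ v = 0 := by
    refine eq_zero_of_forall_isTest fun φ hφ => ?_
    rw [inner_add_right, inner_sum, ← integral_inner_translate hψ hφ v]
    have h1 : ∀ g : Heis n, ψ g • inner ℂ (cls _ (isTest_comp_mul hφ (-g)).continuous) v =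
        -∑ i ∈ s, c i * (ψ g • inner ℂ
          (cls _ (isTest_DL (isTest_comp_mul hφ (-g)) (ξ i)).continuous) (F i)) := by
      intro g
      rw [← neg_neg (inner ℂ (cls _ (isTest_comp_mul hφ (-g)).continuous) v),
        ← h _ (isTest_comp_mul hφ (-g)), smul_neg, Finset.smul_sum]
      congr 1
      refine Finset.sum_congr rfl fun i _ => ?_
      simp only [Complex.real_smul]
      ring
    simp only [h1]
    rw [integral_neg, integral_finsetSum _ fun i _ =>
      (integrable_inner_cls_DL_translate hψ hφ (ξ i) (F i)).const_mul (c i)]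
    simp only [integral_const_mul, integral_inner_cls_DL_translate hψ hφ, inner_smul_right]
    ring
  simp only [moll_DL hψ, smul_sub, smul_neg, Finset.sum_sub_distrib, Finset.sum_neg_distrib] at key
  simp only [gen_apply]
  rw [sub_eq_add_neg, add_right_comm, ← sub_eq_add_neg, sub_eq_zero, neg_add_eq_iff_eq_add] at key
  rw [eq_sub_iff_add_eq, key]

/-! ### Approximation -/

/-- The dilations of a function on the group, normalized to have the same integral. -/
noncomputable def dil (ε : ℝ) (χ : Heis n → ℝ) (g : Heis n) : ℝ :=
  (ε ^ Module.finrank ℝ (Heis n))⁻¹ * χ (ε⁻¹ • g)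

theorem IsBump.dil {χ : Heis n → ℝ} (hχ : IsBump χ) {ε : ℝ} (hε : 0 < ε) : IsBump (dil ε χ) := by
  refine ⟨contDiff_const.mul (hχ.smooth.comp (contDiff_const_smul _)), ?_⟩
  have : HasCompactSupport fun g : Heis n => χ (ε⁻¹ • g) :=
    hχ.support.comp_homeomorph (Homeomorph.smulOfNeZero ε⁻¹ (inv_ne_zero hε.ne'))
  exact this.mul_left

instance : (volume : Measure (Heis n)).IsAddHaarMeasure :=
  Measure.prod.instIsAddHaarMeasure _ _

theorem moll_dil (χ : Heis n → ℝ) (f : SL2 n) {ε : ℝ} (hε : 0 < ε) :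
    moll (dil ε χ) f = ∫ g, χ g • U (ε • g) f := by
  have h := Measure.integral_comp_inv_smul_of_nonneg (volume : Measure (Heis n))
    (fun g => χ g • U (ε • g) f) hε.le
  have hne : ε ^ Module.finrank ℝ (Heis n) ≠ 0 := (pow_pos hε _).ne'
  simp only [smul_inv_smul₀ hε.ne'] at h
  simp only [moll, dil, mul_smul, integral_smul]
  rw [h, smul_smul, inv_mul_cancel₀ hne, one_smul]

theorem tendsto_moll_dil {χ : Heis n → ℝ} (hχ : IsBump χ) (f : SL2 n) :
    Tendsto (fun ε : ℝ => moll (dil ε χ) f) (𝓝[>] 0) (𝓝 ((∫ g, χ g) • f)) := by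
  have h1 : (fun ε : ℝ => moll (dil ε χ) f) =ᶠ[𝓝[>] 0] fun ε => ∫ g, χ g • U (ε • g) f := by
    filter_upwards [self_mem_nhdsWithin] with ε hε using moll_dil χ f hε
  refine Tendsto.congr' h1.symm ?_
  rw [← integral_smul_const]
  have hi : Integrable χ := hχ.smooth.continuous.integrable_of_hasCompactSupport hχ.support
  refine tendsto_integral_filter_of_dominated_convergence (fun g => ‖χ g‖ * ‖f‖) ?_ ?_
    (hi.norm.mul_const _) ?_
  · refine Eventually.of_forall fun ε => Continuous.aestronglyMeasurable ?_
    exact hχ.smooth.continuous.smul ((continuous_U f).comp (continuous_const_smul ε))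
  · refine Eventually.of_forall fun ε => Eventually.of_forall fun g => ?_
    rw [norm_smul, (U _).norm_map]
  · refine Eventually.of_forall fun g => ?_
    have h2 : Tendsto (fun ε : ℝ => ε • g) (𝓝[>] 0) (𝓝 0) := by
      have : Continuous fun ε : ℝ => ε • g := by fun_prop
      simpa using (this.tendsto 0).mono_left nhdsWithin_le_nhds
    exact ((tendsto_U_zero f).comp h2).const_smul (χ g)

theorem integral_DR_center {χ : Heis n → ℝ} (hχ : IsBump χ) (t : Fin 3 → ℝ) :
    ∫ g, DR (0, t) χ g = 0 := by
  have hi : Integrable χ := hχ.smooth.continuous.integrable_of_hasCompactSupport hχ.support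
  have hd : Continuous fun g => fderiv ℝ χ g (0, t) :=
    (hχ.smooth.continuous_fderiv (by simp)).clm_apply continuous_const
  have hs : HasCompactSupport fun g => fderiv ℝ χ g (0, t) := hχ.support.fderiv_apply ℝ _
  have hi' := hd.integrable_of_hasCompactSupport hs (μ := volume)
  have h := integral_mul_fderiv_eq_neg_fderiv_mul_of_integrable (𝕜 := ℝ) (f := χ)
    (g := fun _ => (1 : ℝ)) (v := ((0, t) : Heis n)) (μ := volume) (by simpa using hi') (by simp)
    (by simpa using hi) (fun x _ => hχ.smooth.differentiable (by simp) x) (fun x _ => differentiableAt_const _)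
  have e : ∀ g, DR (0, t) χ g = -fderiv ℝ χ g (0, t) := by
    intro g
    have : ((0, t) : Heis n) + omegaMap (0, t) g = (0, t) := by
      refine Prod.ext (by simp [omegaMap_apply]) (funext fun γ => ?_)
      simp [omegaMap_apply]
    rw [DR, this]
  simp only [e, integral_neg]
  simpa using h

/-- The linear coefficient scales by ε and the derivative by 1/ε, so the two factors cancel. The
isotropic dilation, although not an automorphism of the group, is compatible with central
translations, since these are additive. -/
theorem DR_shearCoeff_dil {χ : Heis n → ℝ} (hχ : IsBump χ) (ξ : Heis n) (β : Fin 3) {ε : ℝ}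
    (hε : 0 < ε) :
    DR (0, Pi.single β 1) (fun g => shearCoeff ξ β g * dil ε χ g) =
      dil ε (DR (0, Pi.single β 1) fun g => shearCoeff ξ β g * χ g) := by
  funext g
  have hb := hχ.mul_left (contDiff_shearCoeff ξ β)
  have hb' := (hχ.dil hε).mul_left (contDiff_shearCoeff ξ β)
  have h1 := hasDerivAt_mul_left hb'.smooth (0, Pi.single β 1) g 0
  have h2 := (hasDerivAt_mul_left hb.smooth (ε⁻¹ • (0, Pi.single β 1)) (ε⁻¹ • g) 0).const_mul
    (ε * (ε ^ Module.finrank ℝ (Heis n))⁻¹)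
  have e : ∀ τ : ℝ, shearCoeff ξ β (mul (-(τ • (0, Pi.single β 1))) g) *
      dil ε χ (mul (-(τ • (0, Pi.single β 1))) g) =
      ε * (ε ^ Module.finrank ℝ (Heis n))⁻¹ * (shearCoeff ξ β
        (mul (-(τ • ε⁻¹ • (0, Pi.single β 1))) (ε⁻¹ • g)) *
        χ (mul (-(τ • ε⁻¹ • (0, Pi.single β 1))) (ε⁻¹ • g))) := by
    intro τ
    have e1 : mul (-(τ • ε⁻¹ • ((0, Pi.single β 1) : Heis n))) (ε⁻¹ • g) =
        ε⁻¹ • mul (-(τ • (0, Pi.single β 1))) g := by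
      refine Prod.ext (by simp [mul_eq]) (funext fun γ => ?_)
      simp [mul_eq]
      ring
    have e2 : ∀ q, shearCoeff ξ β (ε⁻¹ • q) = ε⁻¹ * shearCoeff ξ β q := by
      intro q
      simp [shearCoeff, omega_smul_left]
      ring
    rw [e1, e2, dil]
    field_simp
  simp only [e] at h1
  have h3 := h1.unique h2
  simp only [zero_smul, neg_zero, zero_mul', DR_smul_dir, smul_eq_mul] at h3
  rw [h3, dil]
  field_simp

/-- The kernels are dilations of one fixed central derivative. Mollification by them converges
strongly to the integral of that derivative times f, which is 0. -/
theorem tendsto_moll_shear {χ : Heis n → ℝ} (hχ : IsBump χ) (ξ : Heis n) (β : Fin 3) (f : SL2 n) :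
    Tendsto (fun ε : ℝ => moll (DR (0, Pi.single β 1)
      fun g => shearCoeff ξ β g * dil ε χ g) f) (𝓝[>] 0) (𝓝 0) := by
  have hb := hχ.mul_left (contDiff_shearCoeff ξ β)
  have h := tendsto_moll_dil (hb.DR (0, Pi.single β 1)) f
  rw [integral_DR_center hb, zero_smul] at h
  refine h.congr' ?_
  filter_upwards [self_mem_nhdsWithin] with ε hε
  rw [DR_shearCoeff_dil hχ ξ β hε]

theorem exists_isBump_integral_eq_one : ∃ χ : Heis n → ℝ, IsBump χ ∧ ∫ g, χ g = 1 := by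
  let b : ContDiffBump (0 : Heis n) := default
  exact ⟨b.normed volume, ⟨b.contDiff_normed, b.hasCompactSupport_normed⟩, b.integral_normed⟩

end TangentialCF

namespace TangentialCF
open Filter Topology ComplexConjugate

variable {n : ℕ}

/-! ### The Poincaré inequality -/

/-- The left invariant horizontal frame at the origin. -/
def hor (a : Fin n × Fin 4) : Heis n := (Pi.single a 1, 0)

theorem norm_U_mul_sub_le (g h : Heis n) (f : SL2 n) :
    ‖U (mul g h) f - f‖ ≤ ‖U g f - f‖ + ‖U h f - f‖ := by
  have h1 : U (mul g h) f - f = U g (U h f - f) + (U g f - f) := by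
    rw [U_mul, map_sub]; abel
  rw [h1]
  refine (norm_add_le _ _).trans ?_
  rw [(U g).norm_map, add_comm]

theorem norm_U_horizontal_sub_le {F : SL2 n} {D : Heis n →ₗ[ℝ] SL2 n}
    (hD : ∀ ξ, HasGen ξ F (D ξ)) {x : Fin n × Fin 4 → ℝ} (hx : ∀ a, |x a| ≤ 1) :
    ‖U (x, 0) F - F‖ ≤ ∑ a, ‖D (hor a)‖ := by
  refine (hD (x, 0)).norm_U_sub_le.trans ?_
  have e : ((x, 0) : Heis n) = ∑ a, x a • hor a := by
    refine Prod.ext (funext fun i => ?_) (funext fun β => ?_)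
    · simp [hor, Prod.fst_sum, Pi.single_apply]
    · simp [hor, Prod.snd_sum]
  rw [e, map_sum]
  refine norm_sum_le_of_le _ fun a _ => ?_
  rw [map_smul, norm_smul, Real.norm_eq_abs]
  exact mul_le_of_le_one_left (norm_nonneg _) (hx a)

theorem omega_single (β : Fin 3) (a b : Fin n × Fin 4) :
    omega β (Pi.single a 1) (Pi.single b 1) = if a.1 = b.1 then B β a.2 b.2 else 0 := by
  obtain ⟨l, p⟩ := a
  obtain ⟨l', q⟩ := b
  have h : ∀ (m : Fin n) (k j : Fin 4), B β k j * (Pi.single (l, p) 1 : Fin n × Fin 4 → ℝ) (m, k) *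
      (Pi.single (l', q) 1 : Fin n × Fin 4 → ℝ) (m, j) =
      if m = l then (if k = p then if m = l' then if j = q then B β k j else 0 else 0 else 0)
      else 0 := by
    intro m k j
    simp only [Pi.single_apply, Prod.mk.injEq]
    split_ifs <;> simp_all
  simp only [omega, h]
  simp only [Finset.sum_ite_irrel, Finset.sum_const_zero, Finset.sum_ite_eq',
    Finset.mem_univ, if_true]

/-- The central element is the group commutator of two horizontal elements supported on one
quaternionic line. Each of its four factors costs at most one horizontal displacement. -/
theorem norm_U_center_sub_le (hn : 0 < n) {F : SL2 n} {D : Heis n →ₗ[ℝ] SL2 n}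
    (hD : ∀ ξ, HasGen ξ F (D ξ)) (β : Fin 3) {t : ℝ} (ht : t ∈ Set.Ico (0 : ℝ) 1) :
    ‖U (0, Pi.single β t) F - F‖ ≤ 4 * ∑ a, ‖D (hor a)‖ := by
  -- The commutator of (x, 0) and (y, 0) is (0, 4ω(x, y)), hence the choice 4s² = t.
  set s : ℝ := Real.sqrt t / 2
  have hs : s * s * 4 = t := by
    have := Real.mul_self_sqrt ht.1
    simp only [s]
    linarith
  have hs1 : |s| ≤ 1 := by
    have h1 : Real.sqrt t ≤ 1 := Real.sqrt_le_one.2 ht.2.le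
    have h0 := Real.sqrt_nonneg t
    rw [abs_le]
    constructor <;> simp only [s] <;> linarith
  let b : Fin n × Fin 4 := (⟨0, hn⟩, β.succ)
  let x : Fin n × Fin 4 → ℝ := s • Pi.single b 1
  let y : Fin n × Fin 4 → ℝ := s • Pi.single (⟨0, hn⟩, 0) 1
  have hsingle : ∀ (c : Fin n × Fin 4) a, |(s • Pi.single c 1 : Fin n × Fin 4 → ℝ) a| ≤ 1 := by
    intro c a
    rw [Pi.smul_apply, Pi.single_apply]
    split_ifs
    · simpa using hs1
    · simp
  have hneg : ∀ (c : Fin n × Fin 4) a, |(-(s • Pi.single c 1) : Fin n × Fin 4 → ℝ) a| ≤ 1 := by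
    intro c a
    rw [Pi.neg_apply, abs_neg]
    exact hsingle c a
  have e : ((0, Pi.single β t) : Heis n) =
      mul (mul (x, 0) (y, 0)) (mul (-x, 0) (-y, 0)) := by
    refine Prod.ext ?_ (funext fun γ => ?_)
    · simp only [mul_eq]
      abel
    · have hB : B γ β.succ 0 = if γ = β then 1 else 0 := by
        fin_cases γ <;> fin_cases β <;> simp [B]
      have hω : omega γ x y = if γ = β then s * s else 0 := by
        simp only [x, y]
        rw [omega_smul_left, omega_smul_right, omega_single, if_pos rfl, hB]
        split_ifs <;> simp
      simp only [mul_eq, omega_add_left, omega_add_right, omega_neg_left, omega_neg_right,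
        omega_self, omega_swap γ x y, Pi.zero_apply, hω, Pi.single_apply, ← hs]
      split_ifs <;> ring
  rw [e]
  have h1 := norm_U_mul_sub_le (mul (x, 0) (y, 0)) (mul (-x, 0) (-y, 0)) F
  have h2 := norm_U_mul_sub_le (x, 0) (y, 0) F
  have h3 := norm_U_mul_sub_le (-x, 0) (-y, 0) F
  have hx := norm_U_horizontal_sub_le hD (x := x) (hsingle _)
  have hy := norm_U_horizontal_sub_le hD (x := y) (hsingle _)
  have hx' := norm_U_horizontal_sub_le hD (x := -x) (hneg _)
  have hy' := norm_U_horizontal_sub_le hD (x := -y) (hneg _)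
  linarith

/-- The point is a horizontal element times three central ones, and 13 = 1 + 3 · 4. -/
theorem norm_U_sub_le (hn : 0 < n) {F : SL2 n} {D : Heis n →ₗ[ℝ] SL2 n}
    (hD : ∀ ξ, HasGen ξ F (D ξ)) {g : Heis n} (hg : g ∈ fundDomain n) :
    ‖U g F - F‖ ≤ 13 * ∑ a, ‖D (hor a)‖ := by
  have e : g = mul (mul (g.1, 0) (0, Pi.single 0 (g.2 0)))
      (mul (0, Pi.single 1 (g.2 1)) (0, Pi.single 2 (g.2 2))) := by
    refine Prod.ext ?_ (funext fun γ => ?_)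
    · simp [mul_eq]
    · fin_cases γ <;> simp [mul_eq]
  have h1 := norm_U_mul_sub_le (mul (g.1, 0) (0, Pi.single 0 (g.2 0)))
      (mul (0, Pi.single 1 (g.2 1)) (0, Pi.single 2 (g.2 2))) F
  have h2 := norm_U_mul_sub_le (g.1, 0) (0, Pi.single 0 (g.2 0)) F
  have h3 := norm_U_mul_sub_le (0, Pi.single 1 (g.2 1)) (0, Pi.single 2 (g.2 2)) F
  have h4 := norm_U_horizontal_sub_le hD (x := g.1)
    fun a => abs_le.2 ⟨by linarith [(hg.1 a).1], (hg.1 a).2.le⟩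
  have h5 := fun β => norm_U_center_sub_le hn hD β (hg.2 β)
  rw [← e] at h1
  linarith [h5 0, h5 1, h5 2]

/-- Since ⟨F, U g F⟩ averages to 0, ‖F‖² is the average of ⟨F, F - U g F⟩, bounded by ‖F‖ times the
largest displacement. -/
theorem norm_le_of_integral_eq_zero (hn : 0 < n) {F : SL2 n} {D : Heis n →ₗ[ℝ] SL2 n}
    (hD : ∀ ξ, HasGen ξ F (D ξ)) (hF : ∫ p, F p ∂quotMeasure n = 0) :
    ‖F‖ ≤ 13 * ∑ a, ‖D (hor a)‖ := by
  set S := 13 * ∑ a, ‖D (hor a)‖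
  have hS : 0 ≤ S := by positivity
  have hint : Integrable (fun g => inner ℂ F (U g F)) (quotMeasure n) := by
    refine Integrable.of_bound (C := ‖F‖ * ‖F‖)
      (continuous_const.inner (continuous_U F)).aestronglyMeasurable
      (Eventually.of_forall fun g => ?_)
    exact (norm_inner_le_norm _ _).trans_eq (by rw [(U g).norm_map])
  have h1 : ∫ g, inner ℂ F (F - U g F) ∂quotMeasure n = inner ℂ F F := by
    simp only [inner_sub_right]
    rw [integral_sub (integrable_const _) hint, integral_inner_U hF]
    simp
  have h2 : ‖∫ g, inner ℂ F (F - U g F) ∂quotMeasure n‖ ≤ ‖F‖ * S := by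
    refine (norm_integral_le_of_norm_le_const (C := ‖F‖ * S) ?_).trans_eq (by simp)
    filter_upwards [ae_mem_fundDomain] with g hg
    refine (norm_inner_le_norm _ _).trans (mul_le_mul_of_nonneg_left ?_ (norm_nonneg _))
    rw [norm_sub_rev]
    exact norm_U_sub_le hn hD hg
  rw [h1, inner_self_eq_norm_sq_to_K] at h2
  simp only [norm_pow, Complex.coe_algebraMap, Complex.norm_real, norm_norm] at h2
  rcases (norm_nonneg F).eq_or_lt with h0 | h0
  · rw [← h0]; exact hS
  · nlinarith

theorem norm_sq_le_of_integral_eq_zero (hn : 0 < n) {F : SL2 n} {D : Heis n →ₗ[ℝ] SL2 n}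
    (hD : ∀ ξ, HasGen ξ F (D ξ)) (hF : ∫ p, F p ∂quotMeasure n = 0) :
    ‖F‖ ^ 2 ≤ 676 * n * ∑ a, ‖D (hor a)‖ ^ 2 := by
  have h1 := norm_le_of_integral_eq_zero hn hD hF
  have h2 := sq_sum_le_card_mul_sum_sq (s := Finset.univ) (f := fun a => ‖D (hor a)‖)
  have h3 : ‖F‖ ^ 2 ≤ (13 * ∑ a, ‖D (hor a)‖) ^ 2 := pow_le_pow_left₀ (norm_nonneg _) h1 2
  -- Cauchy–Schwarz over the 4n horizontal directions gives the constant 13² · 4n = 676 n.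
  simp only [Finset.card_univ, Fintype.card_prod, Fintype.card_fin, Nat.cast_mul] at h2
  rw [mul_pow] at h3
  push_cast at h2
  linarith

theorem integral_moll_eq_zero {ψ : Heis n → ℝ} (hψ : IsBump ψ) {f : SL2 n}
    (hf : ∫ p, f p ∂quotMeasure n = 0) : ∫ p, moll ψ f p ∂quotMeasure n = 0 := by
  have h : ∀ f : SL2 n, ∫ p, f p ∂quotMeasure n =
      inner ℂ (cls (fun _ => 1) continuous_const) f := fun f => by
    rw [inner_cls]; simp
  rw [h] at hf ⊢
  rw [inner_moll hψ]
  have h1 : ∀ g, inner ℂ (cls (fun _ => 1) continuous_const) (U g f) = 0 := fun g => by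
    rw [← neg_neg g, ← inner_U_left, U_cls _ fun _ _ _ => rfl, hf]
  simp [h1]

end TangentialCF

namespace TangentialCF
open Filter Topology ComplexConjugate

variable {n : ℕ}

/-! ### The Weitzenböck inequality -/

section algebra
variable {H : Type*} [NormedAddCommGroup H] [InnerProductSpace ℂ H]

/-- The coefficients of `Z_{2l+r}^{A'}` with respect to `Y_{4l+1}, …, Y_{4l+4}`. -/
noncomputable def zeta : Fin 2 → Fin 2 → Fin 4 → ℂ :=
  ![![![0, 0, -1, -Complex.I], ![-1, -Complex.I, 0, 0]],
    ![![1, -Complex.I, 0, 0], ![0, 0, -1, Complex.I]]]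

/-- The combination `Z_A^{A'}` of the horizontal derivatives `y`. -/
noncomputable def zComb (y : Fin n × Fin 4 → H) (A : Fin n × Fin 2) (A' : Fin 2) : H :=
  ∑ p, zeta A.2 A' p • y (A.1, p)

/-- The formal adjoint of `Z_A^{A'}` in terms of the horizontal derivatives `y`. -/
noncomputable def zAdj (y : Fin n × Fin 4 → H) (A : Fin n × Fin 2) (A' : Fin 2) : H :=
  -∑ p, conj (zeta A.2 A' p) • y (A.1, p)

/-- The commutation relations of the horizontal derivatives, after integration by parts. -/
def HeisRel {I : Type*} (y : I → Fin n × Fin 4 → H) (τ : Fin 3 → I → I → ℂ) : Prop :=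
  ∀ a b i j, inner ℂ (y i a) (y j b) - inner ℂ (y i b) (y j a) =
    if a.1 = b.1 then ∑ β, (B β a.2 b.2 : ℂ) * τ β i j else 0

variable {I : Type*} {y : I → Fin n × Fin 4 → H} {τ : Fin 3 → I → I → ℂ}

theorem HeisRel.same (h : HeisRel y τ) (l : Fin n) (p q : Fin 4) (i j : I) :
    inner ℂ (y i (l, p)) (y j (l, q)) - inner ℂ (y i (l, q)) (y j (l, p)) =
      (B 0 p q : ℂ) * τ 0 i j + (B 1 p q : ℂ) * τ 1 i j + (B 2 p q : ℂ) * τ 2 i j := by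
  rw [h (l, p) (l, q) i j, if_pos rfl, Fin.sum_univ_three]

theorem norm_inner_sub_inner_le (a b c d : H) :
    ‖inner ℂ a b - inner ℂ c d‖ ≤ (‖a‖ ^ 2 + ‖b‖ ^ 2 + ‖c‖ ^ 2 + ‖d‖ ^ 2) / 2 := by
  have h1 := norm_inner_le_norm (𝕜 := ℂ) a b
  have h2 := norm_inner_le_norm (𝕜 := ℂ) c d
  have h3 := norm_sub_le (inner ℂ a b) (inner ℂ c d)
  nlinarith [sq_nonneg (‖a‖ - ‖b‖), sq_nonneg (‖c‖ - ‖d‖)]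

/-- On one quaternionic line the matrix B^β joins the four coordinates in two disjoint pairs, and
each pair expresses ±τ^β by the commutation relation. Together they bound 2|τ^β| by half the energy
on that line; averaging over the n lines yields 1/(4n). -/
theorem HeisRel.norm_le (h : HeisRel y τ) (hn : 0 < n) (β : Fin 3) (i j : I) :
    ‖τ β i j‖ ≤ 1 / (4 * n) * (∑ a, ‖y i a‖ ^ 2 + ∑ a, ‖y j a‖ ^ 2) := by
  have key : ∀ l, 2 * ‖τ β i j‖ ≤
      (∑ p, ‖y i (l, p)‖ ^ 2 + ∑ p, ‖y j (l, p)‖ ^ 2) / 2 := by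
    intro l
    have H0 : ∀ p q, ‖inner ℂ (y i (l, p)) (y j (l, q)) - inner ℂ (y i (l, q)) (y j (l, p))‖ =
        ‖τ β i j‖ → ‖τ β i j‖ ≤ (‖y i (l, p)‖ ^ 2 + ‖y j (l, q)‖ ^ 2 + ‖y i (l, q)‖ ^ 2 +
          ‖y j (l, p)‖ ^ 2) / 2 := fun p q e => e ▸ norm_inner_sub_inner_le _ _ _ _
    simp only [Fin.sum_univ_four]
    fin_cases β
    · have h1 := H0 0 1 (by rw [h.same]; simp [B])
      have h2 := H0 2 3 (by rw [h.same]; simp [B])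
      linarith
    · have h1 := H0 0 2 (by rw [h.same]; simp [B])
      have h2 := H0 1 3 (by rw [h.same]; simp [B])
      linarith
    · have h1 := H0 0 3 (by rw [h.same]; simp [B])
      have h2 := H0 1 2 (by rw [h.same]; simp [B])
      linarith
  have h2 := Finset.sum_le_sum fun l (_ : l ∈ Finset.univ) => key l
  rw [Finset.sum_const, Finset.card_univ, Fintype.card_fin, ← Finset.sum_div,
    Finset.sum_add_distrib, nsmul_eq_mul] at h2
  rw [Fintype.sum_prod_type, Fintype.sum_prod_type, one_div, inv_mul_eq_div,
    le_div_iff₀ (by positivity)]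
  linarith

section values
variable (y : Fin n × Fin 4 → H) (l : Fin n)

theorem zComb_zero_zero : zComb y (l, 0) 0 = -y (l, 2) - Complex.I • y (l, 3) := by
  simp [zComb, zeta, Fin.sum_univ_four, sub_eq_add_neg]

theorem zComb_zero_one : zComb y (l, 0) 1 = -y (l, 0) - Complex.I • y (l, 1) := by
  simp [zComb, zeta, Fin.sum_univ_four, sub_eq_add_neg]

theorem zComb_one_zero : zComb y (l, 1) 0 = y (l, 0) - Complex.I • y (l, 1) := by
  simp [zComb, zeta, Fin.sum_univ_four, sub_eq_add_neg]

theorem zComb_one_one : zComb y (l, 1) 1 = -y (l, 2) + Complex.I • y (l, 3) := by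
  simp [zComb, zeta, Fin.sum_univ_four]

end values

/-- All off-diagonal products pair up into commutators. For each β the two disjoint pairs joined by
B^β contribute the same τ^β with opposite signs, so nothing of first order survives. -/
theorem HeisRel.sum_inner_zComb (h : HeisRel y τ) (l : Fin n) (i : Fin 2 → I) :
    ∑ r, inner ℂ (∑ A', zComb (y (i A')) (l, r) A') (∑ A', zComb (y (i A')) (l, r) A') =
      ∑ A', ∑ p, inner ℂ (y (i A') (l, p)) (y (i A') (l, p)) := by
  have h00 := h.same l 0 1 (i 0) (i 0)
  have h01 := h.same l 2 3 (i 0) (i 0)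
  have h10 := h.same l 0 1 (i 1) (i 1)
  have h11 := h.same l 2 3 (i 1) (i 1)
  have a1 := h.same l 2 0 (i 0) (i 1)
  have a2 := h.same l 2 1 (i 0) (i 1)
  have a3 := h.same l 3 0 (i 0) (i 1)
  have a4 := h.same l 3 1 (i 0) (i 1)
  have b1 := h.same l 2 0 (i 1) (i 0)
  have b2 := h.same l 2 1 (i 1) (i 0)
  have b3 := h.same l 3 0 (i 1) (i 0)
  have b4 := h.same l 3 1 (i 1) (i 0)
  simp [B] at h00 h01 h10 h11 a1 a2 a3 a4 b1 b2 b3 b4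
  simp only [Fin.sum_univ_two, Fin.sum_univ_four, zComb_zero_zero, zComb_zero_one,
    zComb_one_zero, zComb_one_one, inner_add_left, inner_add_right, inner_sub_left,
    inner_sub_right, inner_neg_left, inner_neg_right, inner_smul_left, inner_smul_right,
    Complex.conj_I]
  have hI := Complex.I_mul_I
  let a := fun p q (s t : Fin 2) => inner ℂ (y (i s) (l, p)) (y (i t) (l, q))
  linear_combination Complex.I * (h01 - h00 + h10 - h11) + a1 + Complex.I * (a2 - a3) + a4 - b1 +
    Complex.I * (b2 - b3) - b4 - (a 3 3 0 0 + a 1 1 0 0 + a 3 3 1 1 + a 1 1 1 1 + a 3 1 0 1 -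
      a 1 3 0 1 - a 3 1 1 0 + a 1 3 1 0) * hI

/-- Moving each operator to the other side exchanges the two operators. They commute unless they
live on the same quaternionic line, and then the defect is central. -/
theorem HeisRel.inner_zComb (h : HeisRel y τ) (A A₂ : Fin n × Fin 2) (A' B' : Fin 2) (i j : I) :
    inner ℂ (zComb (y i) A A') (zComb (y j) A₂ B') =
      inner ℂ (zAdj (y i) A₂ B') (zAdj (y j) A A') + if A.1 = A₂.1 then
        ∑ β, (∑ p, ∑ q, conj (zeta A.2 A' p) * zeta A₂.2 B' q * B β p q) * τ β i j else 0 := by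
  have h1 : inner ℂ (zAdj (y i) A₂ B') (zAdj (y j) A A') = ∑ p, ∑ q,
      conj (zeta A.2 A' p) * zeta A₂.2 B' q * inner ℂ (y i (A₂.1, q)) (y j (A.1, p)) := by
    rw [zAdj, zAdj, inner_neg_neg, inner_sum]
    refine Finset.sum_congr rfl fun p _ => ?_
    rw [sum_inner]
    refine Finset.sum_congr rfl fun q _ => ?_
    rw [inner_smul_left, inner_smul_right, Complex.conj_conj]
    ring
  have h2 : inner ℂ (zComb (y i) A A') (zComb (y j) A₂ B') = ∑ p, ∑ q,
      conj (zeta A.2 A' p) * zeta A₂.2 B' q * inner ℂ (y i (A.1, p)) (y j (A₂.1, q)) := by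
    rw [zComb, zComb, sum_inner]
    refine Finset.sum_congr rfl fun p _ => ?_
    rw [inner_sum]
    refine Finset.sum_congr rfl fun q _ => ?_
    rw [inner_smul_left, inner_smul_right]
    ring
  rw [← sub_eq_iff_eq_add', h1, h2]
  simp only [← Finset.sum_sub_distrib, ← mul_sub]
  simp only [h (A.1, _) (A₂.1, _) i j]
  split_ifs
  · simp only [Finset.mul_sum, Finset.sum_mul]
    refine (Finset.sum_congr rfl fun p _ => Finset.sum_comm).trans (Finset.sum_comm.trans ?_)
    refine Finset.sum_congr rfl fun β _ => Finset.sum_congr rfl fun p _ =>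
      Finset.sum_congr rfl fun q _ => by ring
  · simp

theorem zeta_B_of_ne (r s A' B' : Fin 2) (hne : A' ≠ B') (β : Fin 3) :
    ∑ p, ∑ q, conj (zeta r A' p) * zeta s B' q * B β p q = 0 := by
  fin_cases r <;> fin_cases s <;> fin_cases A' <;> fin_cases B' <;> fin_cases β <;>
    first
      | exact absurd rfl hne
      | simp [zeta, B, Fin.sum_univ_four]

/-- For equal unprimed parities only the first central direction appears, for different ones only
the other two. This count leads to the constant 3 in `HeisRel.norm_commTerm_le`. -/
theorem norm_zeta_B (r s A' : Fin 2) (β : Fin 3) :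
    ‖∑ p, ∑ q, conj (zeta r A' p) * zeta s A' q * B β p q‖ =
      if (β = 0 ↔ r = s) then 2 else 0 := by
  fin_cases r <;> fin_cases s <;> fin_cases A' <;> fin_cases β <;>
    simp [zeta, B, Fin.sum_univ_four] <;> rw [← two_mul, norm_mul] <;> simp

end algebra

end TangentialCF

namespace TangentialCF
open Filter Topology ComplexConjugate

variable {n : ℕ}

section symmetrization
-- Symmetrization of tuples
variable {H : Type*} [NormedAddCommGroup H] [InnerProductSpace ℂ H]

/-- The symmetrization of a tuple in all of its indices. -/
noncomputable def symmetrize {m : ℕ} {α : Type*} (W : (Fin m → α) → H) (Q : Fin m → α) : H :=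
  (m.factorial : ℂ)⁻¹ • ∑ σ : Equiv.Perm (Fin m), W (Q ∘ σ)

theorem sum_comp_perm {m : ℕ} {α M : Type*} [Fintype α] [AddCommMonoid M]
    (σ : Equiv.Perm (Fin m)) (G : (Fin m → α) → M) : ∑ Q, G (Q ∘ σ) = ∑ Q, G Q :=
  Fintype.sum_equiv (σ.symm.arrowCongr (Equiv.refl α)) _ _ fun Q => by
    congr 1

/-- Symmetrization is an orthogonal projection S, so ‖SW‖² = ⟨W, SW⟩. -/
theorem sum_inner_symmetrize {m : ℕ} {α : Type*} [Fintype α] (W : (Fin m → α) → H) :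
    ∑ Q, inner ℂ (symmetrize W Q) (symmetrize W Q) =
      (m.factorial : ℂ)⁻¹ * ∑ σ : Equiv.Perm (Fin m), ∑ Q, inner ℂ (W Q) (W (Q ∘ σ)) := by
  have hm : (m.factorial : ℂ) ≠ 0 := Nat.cast_ne_zero.2 m.factorial_ne_zero
  have h1 : ∀ σ : Equiv.Perm (Fin m), ∑ τ : Equiv.Perm (Fin m), ∑ Q,
      inner ℂ (W (Q ∘ σ)) (W (Q ∘ τ)) =
      ∑ τ : Equiv.Perm (Fin m), ∑ Q, inner ℂ (W Q) (W (Q ∘ τ)) := by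
    intro σ
    refine Fintype.sum_equiv (Equiv.mulLeft σ⁻¹) _ _ fun τ => ?_
    rw [← sum_comp_perm σ fun Q => inner ℂ (W Q) (W (Q ∘ ⇑(Equiv.mulLeft σ⁻¹ τ)))]
    refine Finset.sum_congr rfl fun Q _ => ?_
    have e : (Q ∘ σ) ∘ ⇑(σ⁻¹ * τ) = Q ∘ τ := by
      funext x; simp
    rw [Equiv.coe_mulLeft, e]
  have h2 : ∀ Q, inner ℂ (symmetrize W Q) (symmetrize W Q) = (m.factorial : ℂ)⁻¹ *
      ((m.factorial : ℂ)⁻¹ * ∑ σ : Equiv.Perm (Fin m), ∑ τ : Equiv.Perm (Fin m),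
        inner ℂ (W (Q ∘ σ)) (W (Q ∘ τ))) := by
    intro Q
    rw [symmetrize, inner_smul_left, inner_smul_right, sum_inner]
    simp only [inner_sum, map_inv₀, Complex.conj_natCast]
  simp only [h2, ← Finset.mul_sum]
  congr 1
  rw [Finset.sum_comm]
  have h3 : ∀ σ : Equiv.Perm (Fin m), ∑ Q, ∑ τ : Equiv.Perm (Fin m),
      inner ℂ (W (Q ∘ σ)) (W (Q ∘ τ)) =
      ∑ τ : Equiv.Perm (Fin m), ∑ Q, inner ℂ (W Q) (W (Q ∘ τ)) := fun σ => by
    rw [Finset.sum_comm, h1]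
  simp only [h3, Finset.sum_const, Finset.card_univ, Fintype.card_perm, Fintype.card_fin,
    nsmul_eq_mul]
  rw [← mul_assoc, inv_mul_cancel₀ hm, one_mul]

/-- The stabilizer of 0 has exactly two double cosets: itself and the one containing the
transposition (0 1). -/
theorem exists_perm_eq_of_apply_ne_zero {m : ℕ} (σ : Equiv.Perm (Fin (m + 2))) (h : σ 0 ≠ 0) :
    ∃ ρ₁ ρ₂ : Equiv.Perm (Fin (m + 2)), ρ₁ 0 = 0 ∧ ρ₂ 0 = 0 ∧ σ = ρ₁ * Equiv.swap 0 1 * ρ₂ := by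
  refine ⟨Equiv.swap 1 (σ 0), Equiv.swap 0 1 * Equiv.swap 1 (σ 0) * σ, ?_, ?_, ?_⟩
  · exact Equiv.swap_apply_of_ne_of_ne (by simp) h.symm
  · simp
  · ext x; simp

/-- For a tuple which is symmetric in all but its first index, transposing the first two indices
gives a lower bound for the norm of the symmetrization. -/
theorem re_sum_inner_swap_le {m : ℕ} {α : Type*} [Fintype α] (W : (Fin (m + 2) → α) → H)
    (hW : ∀ (ρ : Equiv.Perm (Fin (m + 2))) Q, ρ 0 = 0 → W (Q ∘ ρ) = W Q) :
    (∑ Q, inner ℂ (W Q) (W (Q ∘ Equiv.swap 0 1))).re ≤ ∑ Q, ‖symmetrize W Q‖ ^ 2 := by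
  set X := ∑ Q, inner ℂ (W Q) (W (Q ∘ Equiv.swap 0 1))
  have h1 : X.re ≤ ∑ Q, ‖W Q‖ ^ 2 := by
    have h2 : ∀ Q, (inner ℂ (W Q) (W (Q ∘ Equiv.swap 0 1))).re ≤
        (‖W Q‖ ^ 2 + ‖W (Q ∘ Equiv.swap 0 1)‖ ^ 2) / 2 := by
      intro Q
      have h3 := (Complex.re_le_norm _).trans
        (norm_inner_le_norm (𝕜 := ℂ) (W Q) (W (Q ∘ Equiv.swap 0 1)))
      nlinarith [sq_nonneg (‖W Q‖ - ‖W (Q ∘ Equiv.swap 0 1)‖)]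
    have h3 := Finset.sum_le_sum fun Q (_ : Q ∈ Finset.univ) => h2 Q
    rw [← Finset.sum_div, Finset.sum_add_distrib,
      sum_comp_perm (Equiv.swap 0 1) fun Q => ‖W Q‖ ^ 2] at h3
    simp only [X, Complex.re_sum]
    linarith
  -- ‖SW‖² is the average of these pairings over σ. Permutations fixing 0 give ‖W‖², which dominates
  -- Re X by Cauchy–Schwarz; all others lie in the double coset of (0 1) and give X itself.
  have h4 : ∀ σ : Equiv.Perm (Fin (m + 2)), X.re ≤ (∑ Q, inner ℂ (W Q) (W (Q ∘ σ))).re := by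
    intro σ
    by_cases hσ : σ 0 = 0
    · simp only [hW σ _ hσ]
      refine h1.trans_eq ?_
      simp only [Complex.re_sum]
      refine Finset.sum_congr rfl fun Q _ => ?_
      exact (inner_self_eq_norm_sq (𝕜 := ℂ) (W Q)).symm
    · obtain ⟨ρ₁, ρ₂, e1, e2, rfl⟩ := exists_perm_eq_of_apply_ne_zero σ hσ
      refine le_of_eq (congrArg Complex.re ?_)
      simp only [X]
      rw [← sum_comp_perm ρ₁ fun Q => inner ℂ (W Q) (W (Q ∘ Equiv.swap 0 1))]
      refine Finset.sum_congr rfl fun Q _ => ?_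
      have e : Q ∘ ⇑(ρ₁ * Equiv.swap 0 1 * ρ₂ : Equiv.Perm (Fin (m + 2))) =
          ((Q ∘ ρ₁) ∘ Equiv.swap 0 1) ∘ ρ₂ := rfl
      rw [e, hW ρ₂ _ e2, hW ρ₁ _ e1]
  clear_value X
  have h5 : ∑ Q, ‖symmetrize W Q‖ ^ 2 =
      (∑ Q, inner ℂ (symmetrize W Q) (symmetrize W Q)).re := by
    simp only [Complex.re_sum]
    refine Finset.sum_congr rfl fun Q _ => ?_
    exact (inner_self_eq_norm_sq (𝕜 := ℂ) (symmetrize W Q)).symm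
  have hm : (0 : ℝ) < (m + 2).factorial := Nat.cast_pos.2 (Nat.factorial_pos _)
  rw [h5, sum_inner_symmetrize, ← Complex.ofReal_natCast, ← Complex.ofReal_inv,
    Complex.re_ofReal_mul, Complex.re_sum, inv_mul_eq_div, le_div_iff₀ hm]
  refine le_trans (le_of_eq ?_) (Finset.sum_le_sum fun σ _ => h4 σ)
  rw [Finset.sum_const, Finset.card_univ, Fintype.card_perm, Fintype.card_fin, nsmul_eq_mul,
    mul_comm]

end symmetrization

/-! ### The Weitzenböck inequality for 𝒱₁-valued tuples -/

section weitzenboeck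
variable {H : Type*} [NormedAddCommGroup H] [InnerProductSpace ℂ H] {K : ℕ}

/-- The index set of the components of `𝒱₁`-valued functions. -/
abbrev Idx₁ (n K : ℕ) : Type := (Fin n × Fin 2) × (Fin (K + 1) → Fin 2)

/-- The contraction `∑_{A'} Z_A^{A'} f_{B A' P}` in terms of the horizontal derivatives `y`. -/
noncomputable def xComb (y : Idx₁ n K → Fin n × Fin 4 → H) (A A₂ : Fin n × Fin 2)
    (P : Fin K → Fin 2) : H :=
  ∑ A' : Fin 2, zComb (y (A₂, Fin.cons A' P)) A A'

/-- The contraction `∑_B (Z_B^{A'})^* f_{B R}` in terms of the horizontal derivatives `y`, where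
`Q = (A', R)`. -/
noncomputable def wComb (y : Idx₁ n K → Fin n × Fin 4 → H) (Q : Fin (K + 2) → Fin 2) : H :=
  ∑ A₂ : Fin n × Fin 2, zAdj (y (A₂, Fin.tail Q)) A₂ (Q 0)

theorem sum_cons {m : ℕ} {α M : Type*} [Fintype α] [AddCommMonoid M] (G : (Fin (m + 1) → α) → M) :
    ∑ R, G R = ∑ P : Fin m → α, ∑ a : α, G (Fin.cons a P) := by
  rw [Finset.sum_comm, ← Fintype.sum_prod_type']
  exact (Fintype.sum_equiv (Fin.consEquiv fun _ => α) _ _ fun _ => rfl).symm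

variable {y : Idx₁ n K → Fin n × Fin 4 → H} {τ : Fin 3 → Idx₁ n K → Idx₁ n K → ℂ}

theorem HeisRel.sum_norm_xComb (h : HeisRel y τ) :
    ∑ A, ∑ A₂, ∑ P, ‖xComb y A A₂ P‖ ^ 2 = ∑ i, ∑ a, ‖y i a‖ ^ 2 := by
  have h1 : ∀ (l : Fin n) (A₂ : Fin n × Fin 2) (P : Fin K → Fin 2),
      ∑ r, ‖xComb y (l, r) A₂ P‖ ^ 2 = ∑ A' : Fin 2, ∑ p, ‖y (A₂, Fin.cons A' P) (l, p)‖ ^ 2 := by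
    intro l A₂ P
    have := h.sum_inner_zComb l fun A' => (A₂, Fin.cons A' P)
    simp only [inner_self_eq_norm_sq_to_K] at this
    exact_mod_cast this
  rw [Fintype.sum_prod_type]
  have h2 : ∀ l : Fin n, ∑ r, ∑ A₂, ∑ P, ‖xComb y (l, r) A₂ P‖ ^ 2 =
      ∑ A₂ : Fin n × Fin 2, ∑ R : Fin (K + 1) → Fin 2, ∑ p, ‖y (A₂, R) (l, p)‖ ^ 2 := by
    intro l
    rw [Finset.sum_comm]
    refine Finset.sum_congr rfl fun A₂ _ => ?_
    rw [Finset.sum_comm, sum_cons]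
    exact Finset.sum_congr rfl fun P _ => h1 l A₂ P
  simp only [h2]
  rw [Fintype.sum_prod_type (fun i : Idx₁ n K => ∑ a, ‖y i a‖ ^ 2), Finset.sum_comm]
  refine Finset.sum_congr rfl fun A₂ _ => ?_
  rw [Finset.sum_comm]
  refine Finset.sum_congr rfl fun R _ => ?_
  rw [Fintype.sum_prod_type]

/-- The commutator term of the Weitzenböck formula. -/
noncomputable def commTerm (τ : Fin 3 → Idx₁ n K → Idx₁ n K → ℂ) (l : Fin n)
    (A' : Fin 2) (R : Fin (K + 1) → Fin 2) : ℂ :=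
  ∑ r, ∑ s, ∑ β, (∑ p, ∑ q, conj (zeta r A' p) * zeta s A' q * B β p q) *
    τ β ((l, s), R) ((l, r), R)

/-- Equal unprimed indices contribute 1/n times the energy through one central direction. The two
mixed pairs contribute 2/n through two directions each. -/
theorem HeisRel.norm_commTerm_le (h : HeisRel y τ) (hn : 0 < n) (l : Fin n) (A' : Fin 2)
    (R : Fin (K + 1) → Fin 2) :
    ‖commTerm τ l A' R‖ ≤ 3 / n * ∑ r, ∑ a, ‖y ((l, r), R) a‖ ^ 2 := by
  have h1 : ‖commTerm τ l A' R‖ ≤ ∑ r, ∑ s, ∑ β, (if ((β : Fin 3) = 0 ↔ r = s) then 2 else 0) *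
      (1 / (4 * n) * (∑ a, ‖y ((l, s), R) a‖ ^ 2 + ∑ a, ‖y ((l, r), R) a‖ ^ 2)) := by
    refine norm_sum_le_of_le _ fun r _ => norm_sum_le_of_le _ fun s _ =>
      norm_sum_le_of_le _ fun β _ => ?_
    rw [norm_mul, norm_zeta_B]
    refine mul_le_mul_of_nonneg_left (h.norm_le hn β _ _) ?_
    split_ifs <;> norm_num
  refine h1.trans (le_of_eq ?_)
  simp [Fin.sum_univ_two, Fin.sum_univ_three]
  field_simp
  ring

/-- After the exchange of operators the sums over the two unprimed indices factor, leaving W at (B',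
A', P) paired with W at (A', B', P). Commutators with A' ≠ B' vanish by `zeta_B_of_ne`, so only the
diagonal ones remain. -/
theorem HeisRel.sum_inner_xComb (h : HeisRel y τ) :
    ∑ A, ∑ A₂, ∑ P, inner ℂ (xComb y A A₂ P) (xComb y A₂ A P) =
      ∑ Q, inner ℂ (wComb y Q) (wComb y (Q ∘ Equiv.swap 0 1)) +
        ∑ P : Fin K → Fin 2, ∑ A' : Fin 2, ∑ l, commTerm τ l A' (Fin.cons A' P) := by
  let G : (Fin K → Fin 2) → Fin 2 → Fin 2 → Fin n × Fin 2 → Fin n × Fin 2 → ℂ :=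
    fun P A' B' A A₂ => ∑ β, (∑ p, ∑ q, conj (zeta A.2 A' p) * zeta A₂.2 B' q * B β p q) *
      τ β (A₂, Fin.cons A' P) (A, Fin.cons B' P)
  have h1 : ∀ (P : Fin K → Fin 2), ∑ A, ∑ A₂, inner ℂ (xComb y A A₂ P) (xComb y A₂ A P) =
      ∑ A' : Fin 2, ∑ B' : Fin 2, (inner ℂ (wComb y (Fin.cons B' (Fin.cons A' P)))
        (wComb y (Fin.cons A' (Fin.cons B' P))) +
        ∑ A, ∑ A₂, if A.1 = A₂.1 then G P A' B' A A₂ else 0) := by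
    intro P
    have h2 : ∀ A A₂, inner ℂ (xComb y A A₂ P) (xComb y A₂ A P) =
        ∑ A' : Fin 2, ∑ B' : Fin 2, (inner ℂ (zAdj (y (A₂, Fin.cons A' P)) A₂ B')
          (zAdj (y (A, Fin.cons B' P)) A A') + if A.1 = A₂.1 then G P A' B' A A₂ else 0) := by
      intro A A₂
      rw [xComb, xComb, sum_inner]
      refine Finset.sum_congr rfl fun A' _ => ?_
      rw [inner_sum]
      exact Finset.sum_congr rfl fun B' _ => h.inner_zComb A A₂ A' B' _ _
    simp only [h2]
    rw [Finset.sum_congr rfl fun A _ => Finset.sum_comm, Finset.sum_comm]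
    refine Finset.sum_congr rfl fun A' _ => ?_
    rw [Finset.sum_congr rfl fun A _ => Finset.sum_comm, Finset.sum_comm]
    refine Finset.sum_congr rfl fun B' _ => ?_
    simp only [Finset.sum_add_distrib]
    congr 1
    rw [wComb, wComb, inner_sum]
    refine Finset.sum_congr rfl fun A _ => ?_
    rw [sum_inner]
    simp
  have h3 : ∀ (P : Fin K → Fin 2) (A' B' : Fin 2),
      (∑ A, ∑ A₂, if A.1 = A₂.1 then G P A' B' A A₂ else 0) =
        if A' = B' then ∑ l, commTerm τ l A' (Fin.cons A' P) else 0 := by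
    intro P A' B'
    split_ifs with hAB
    · subst hAB
      simp only [Fintype.sum_prod_type]
      refine Finset.sum_congr rfl fun l _ => ?_
      rw [commTerm]
      refine Finset.sum_congr rfl fun r _ => ?_
      rw [Finset.sum_comm]
      simp [G]
    · refine Finset.sum_eq_zero fun A _ => Finset.sum_eq_zero fun A₂ _ => ?_
      simp only [G, zeta_B_of_ne _ _ _ _ hAB]
      simp
  rw [Finset.sum_congr rfl fun A _ => Finset.sum_comm, Finset.sum_comm]
  simp only [h1, h3, Finset.sum_add_distrib, Finset.sum_ite_eq, Finset.mem_univ, if_true]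
  congr 1
  rw [sum_cons, sum_cons]
  refine Finset.sum_congr rfl fun P _ => Finset.sum_congr rfl fun A' _ =>
    Finset.sum_congr rfl fun B' _ => ?_
  congr 2
  funext x
  refine Fin.cases ?_ (fun x => Fin.cases ?_ (fun x => ?_) x) x
  · simp
  · simp
  · rw [Function.comp_apply, Equiv.swap_apply_of_ne_of_ne (Fin.succ_ne_zero _) (by
      rw [← Fin.succ_zero_eq_one, Ne, Fin.succ_inj]; exact Fin.succ_ne_zero _)]
    simp

theorem HeisRel.weitzenboeck (h : HeisRel y τ) (hn : 0 < n)
    (hy : ∀ A R (σ : Equiv.Perm (Fin (K + 1))), y (A, R ∘ σ) = y (A, R)) :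
    2 * (1 - 3 / n) * ∑ i, ∑ a, ‖y i a‖ ^ 2 ≤
      ∑ A, ∑ A₂, ∑ P, ‖xComb y A A₂ P - xComb y A₂ A P‖ ^ 2 +
        2 * ∑ Q, ‖symmetrize (wComb y) Q‖ ^ 2 := by
  have h1 : ∑ A, ∑ A₂, ∑ P, ‖xComb y A A₂ P - xComb y A₂ A P‖ ^ 2 =
      2 * ∑ i, ∑ a, ‖y i a‖ ^ 2 -
        2 * (∑ A, ∑ A₂, ∑ P, inner ℂ (xComb y A A₂ P) (xComb y A₂ A P)).re := by
    simp only [@norm_sub_sq ℂ, Finset.sum_add_distrib, Finset.sum_sub_distrib, ← Finset.mul_sum,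
      Complex.re_sum]
    rw [h.sum_norm_xComb, Finset.sum_comm (f := fun A A₂ => ∑ P, ‖xComb y A₂ A P‖ ^ 2),
      h.sum_norm_xComb]
    simp only [RCLike.re_to_complex]
    ring
  have h2 : (∑ Q, inner ℂ (wComb y Q) (wComb y (Q ∘ Equiv.swap 0 1))).re ≤
      ∑ Q, ‖symmetrize (wComb y) Q‖ ^ 2 := by
    refine re_sum_inner_swap_le _ fun ρ Q hρ => ?_
    -- A permutation fixing 0 acts on the tail of Q only, and f is symmetric there.
    obtain ⟨⟨p, e⟩, rfl⟩ := Equiv.Perm.decomposeFin.symm.surjective ρ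
    rw [Equiv.Perm.decomposeFin_symm_apply_zero] at hρ
    subst hρ
    have ht : Fin.tail (Q ∘ Equiv.Perm.decomposeFin.symm (0, e)) = Fin.tail Q ∘ e := by
      funext x
      simp [Fin.tail, Equiv.Perm.decomposeFin_symm_apply_succ]
    simp only [wComb, ht, hy]
    simp
  have h3 : ‖∑ P : Fin K → Fin 2, ∑ A' : Fin 2, ∑ l, commTerm τ l A' (Fin.cons A' P)‖ ≤
      3 / n * ∑ i, ∑ a, ‖y i a‖ ^ 2 := by
    refine (norm_sum_le_of_le _ fun P _ => norm_sum_le_of_le _ fun A' _ =>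
      norm_sum_le_of_le _ fun l _ => h.norm_commTerm_le hn l A' (Fin.cons A' P)).trans
      (le_of_eq ?_)
    simp only [← Finset.mul_sum]
    congr 1
    refine Eq.symm ?_
    rw [Fintype.sum_prod_type, Finset.sum_comm, sum_cons]
    exact Finset.sum_congr rfl fun P _ => Finset.sum_congr rfl fun A' _ =>
      Fintype.sum_prod_type _
  rw [h.sum_inner_xComb, Complex.add_re] at h1
  have h4 := (Complex.re_le_norm _).trans h3
  rw [h1]
  linarith

end weitzenboeck

end TangentialCF

namespace TangentialCF
open Filter Topology ComplexConjugate

variable {n : ℕ}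

/-! ### Mollified relations -/

/-- The Lie bracket of two horizontal frame vectors is 4B^β in the central direction β. The 4 is
absorbed in τ. -/
theorem heisRel_gen {I : Type*} {ψ : Heis n → ℝ} (hψ : IsBump ψ) (F : I → SL2 n) :
    HeisRel (fun i a => gen hψ (F i) (hor a)) fun β i j =>
      4 * inner ℂ (gen hψ (F i) (0, Pi.single β 1)) (moll ψ (F j)) := by
  intro a b i j
  rw [inner_gen_gen_sub]
  obtain ⟨κ, hκ⟩ : ∃ κ : Fin 3 → ℝ, κ = fun β => 4 * if a.1 = b.1 then B β a.2 b.2 else 0 :=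
    ⟨_, rfl⟩
  have e : (2 : ℕ) • omegaMap (hor a) (hor b) = ∑ β, κ β • ((0, Pi.single β 1) : Heis n) := by
    refine Prod.ext (funext fun i => ?_) (funext fun β => ?_)
    · simp [omegaMap_apply, Prod.fst_sum]
    · have h1 : ((2 : ℕ) • omegaMap (hor a) (hor b)).2 β = κ β := by
        simp only [hκ, ← omega_single, two_smul, omegaMap_apply, Prod.snd_add, Pi.add_apply, hor]
        ring
      rw [h1]
      simp [Prod.snd_sum, Pi.single_apply]
  rw [e, map_sum, sum_inner]
  split_ifs with hab
  · refine Finset.sum_congr rfl fun β _ => ?_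
    rw [map_smul, inner_smul_left_eq_smul, Complex.real_smul, hκ]
    simp only [if_pos hab]
    push_cast
    ring
  · simp [hκ, hab]

/-- Friedrichs' lemma: the derivatives of the separate F i need not converge, but the combination
controlled by the equation does, because the commutator errors vanish in the limit. -/
theorem tendsto_sum_smul_moll {ι : Type*} (s : Finset ι) (c : ι → ℂ) (ξ : ι → Heis n)
    (F : ι → SL2 n) (v : SL2 n)
    (h : ∀ φ (hφ : IsTest φ), ∑ i ∈ s, c i * inner ℂ
      (cls _ (isTest_DL hφ (ξ i)).continuous) (F i) = -inner ℂ (cls φ hφ.continuous) v)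
    {χ : Heis n → ℝ} (hχ : IsBump χ) (h1 : ∫ g, χ g = 1) :
    Tendsto (fun ε : ℝ => ∑ i ∈ s, c i • moll (DR (ξ i) (dil ε χ)) (F i)) (𝓝[>] 0) (𝓝 v) := by
  have h2 : Tendsto (fun ε : ℝ => moll (dil ε χ) v - ∑ i ∈ s, c i • ∑ β,
      moll (DR (0, Pi.single β 1) (fun g => shearCoeff (ξ i) β g * dil ε χ g)) (F i))
      (𝓝[>] 0) (𝓝 (v - ∑ i ∈ s, c i • ∑ β : Fin 3, 0)) := by
    refine Tendsto.sub ?_ (tendsto_finsetSum _ fun i _ => Tendsto.const_smul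
      (tendsto_finsetSum _ fun β _ => tendsto_moll_shear hχ (ξ i) β (F i)) _)
    simpa [h1] using tendsto_moll_dil hχ v
  simp only [Finset.sum_const_zero, smul_zero, sub_zero] at h2
  refine h2.congr' ?_
  filter_upwards [self_mem_nhdsWithin] with ε hε
  exact (sum_smul_gen_eq s c ξ F v h (hχ.dil hε)).symm

/-! ### Components -/

section components
variable {k j : ℕ}

/-- The component functional on `𝒱_j`. -/
noncomputable def coordV (a : Idx n k j) : V n k j →L[ℂ] ℂ :=
  (EuclideanSpace.proj a : EuclideanSpace ℂ (Idx n k j) →L[ℂ] ℂ).comp (V n k j).subtypeL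

/-- The components of a square integrable function, as square integrable functions. -/
noncomputable def cpt (f : L2 n k j) (a : Idx n k j) : SL2 n := (coordV a).compLp f

theorem coeFn_cpt (f : L2 n k j) (a : Idx n k j) : cpt f a =ᵐ[quotMeasure n] comp f a :=
  (coordV a).coeFn_compLp f

theorem inner_eq_sum_cpt (f g : L2 n k j) :
    inner ℂ f g = ∑ a, inner ℂ (cpt f a) (cpt g a) := by
  simp only [L2.inner_def]
  rw [← integral_finsetSum _ fun a _ => L2.integrable_inner (𝕜 := ℂ) (cpt f a) (cpt g a)]
  refine integral_congr_ae ?_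
  have hf : ∀ᵐ p ∂quotMeasure n, ∀ a, cpt f a p = comp f a p := ae_all_iff.2 fun a => coeFn_cpt f a
  have hg : ∀ᵐ p ∂quotMeasure n, ∀ a, cpt g a p = comp g a p := ae_all_iff.2 fun a => coeFn_cpt g a
  filter_upwards [hf, hg] with p h1 h2
  simp only [h1, h2]
  rw [Submodule.coe_inner, PiLp.inner_apply]
  rfl

theorem norm_sq_eq_sum_cpt (f : L2 n k j) : ‖f‖ ^ 2 = ∑ a, ‖cpt f a‖ ^ 2 := by
  have h := congrArg Complex.re (inner_eq_sum_cpt f f)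
  rw [Complex.re_sum] at h
  refine (inner_self_eq_norm_sq (𝕜 := ℂ) f).symm.trans (h.trans ?_)
  exact Finset.sum_congr rfl fun a _ => inner_self_eq_norm_sq (𝕜 := ℂ) (cpt f a)

theorem cpt_perm (f : L2 n k j) (σ : Equiv.Perm (Fin j)) (ρ : Equiv.Perm (Fin (k - j)))
    (A : Fin j → Fin n × Fin 2) (P : Fin (k - j) → Fin 2) :
    cpt f (A ∘ σ, P ∘ ρ) = ((Equiv.Perm.sign σ : ℤ) : ℂ) • cpt f (A, P) := by
  refine Lp.ext ?_
  filter_upwards [coeFn_cpt f (A ∘ σ, P ∘ ρ), coeFn_cpt f (A, P),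
    Lp.coeFn_smul ((Equiv.Perm.sign σ : ℤ) : ℂ) (cpt f (A, P))] with p h1 h2 h3
  rw [h1, h3, Pi.smul_apply, h2, smul_eq_mul]
  exact (f p).2 σ ρ A P

theorem integral_cpt_eq_zero {f : L2 n k j} (hf : OrthConst f) (a : Idx n k j) :
    ∫ p, cpt f a p ∂quotMeasure n = 0 := by
  -- The constant vector tested is the Riesz representative of the component functional.
  rw [← hf ((InnerProductSpace.toDual ℂ (V n k j)).symm (coordV a))]
  refine integral_congr_ae ?_
  filter_upwards [coeFn_cpt f a] with p hp
  rw [hp, InnerProductSpace.toDual_symm_apply]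
  rfl

theorem integral_comp_mul_eq (f : L2 n k j) (a : Idx n k j) {φ : Heis n → ℂ} (hφ : Continuous φ) :
    ∫ p, comp f a p * φ p ∂quotMeasure n =
      inner ℂ (cls (fun p => conj (φ p)) (Complex.continuous_conj.comp hφ)) (cpt f a) := by
  rw [inner_cls]
  refine integral_congr_ae ?_
  filter_upwards [coeFn_cpt f a] with p hp
  rw [hp, Complex.conj_conj, mul_comm]

theorem Z_eq_sum_DL (A : Fin n × Fin 2) (A' : Fin 2) {φ : Heis n → ℂ} (hφ : IsTest φ)
    (p : Heis n) : Z A A' φ p = ∑ q, zeta A.2 A' q * DL (hor (A.1, q)) φ p := by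
  obtain ⟨l, r⟩ := A
  simp only [hor, ← Y_eq_DL _ hφ.smooth]
  fin_cases r <;> fin_cases A' <;> simp [Z, zeta, Fin.sum_univ_four] <;> ring

theorem distZ_comp (A : Fin n × Fin 2) (A' : Fin 2) (f : L2 n k j) (a : Idx n k j)
    {φ : Heis n → ℂ} (hφ : IsTest φ) :
    distZ A A' (comp f a) φ = -∑ q, zeta A.2 A' q * inner ℂ
      (cls _ (isTest_DL hφ.conj (hor (A.1, q))).continuous) (cpt f a) := by
  have h : ∀ q, inner ℂ (cls _ (isTest_DL hφ.conj (hor (A.1, q))).continuous) (cpt f a) =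
      ∫ p, comp f a p * DL (hor (A.1, q)) φ p ∂quotMeasure n := by
    intro q
    rw [integral_comp_mul_eq f a (isTest_DL hφ _).continuous]
    congr 2
    funext p
    exact DL_conj hφ _ p
  simp only [distZ, h, Z_eq_sum_DL A A' hφ, ← integral_const_mul]
  rw [← integral_finsetSum]
  · congr 1
    refine integral_congr_ae (Eventually.of_forall fun p => ?_)
    simp only [Finset.mul_sum]
    exact Finset.sum_congr rfl fun q _ => by ring
  · exact fun q _ => (integrable_comp_mul f a (isTest_DL hφ _).continuous).const_mul _

/-- The product of a scalar function and a constant vector. -/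
noncomputable def vecCls (φ : Heis n → ℂ) (hφ : Continuous φ) (e : V n k j) : L2 n k j :=
  ((ContinuousLinearMap.id ℂ ℂ).smulRight e).compLp (cls φ hφ)

theorem cpt_vecCls {φ : Heis n → ℂ} (hφ : Continuous φ) (e : V n k j) (a : Idx n k j) :
    cpt (vecCls φ hφ e) a = (e : EuclideanSpace ℂ (Idx n k j)) a • cls φ hφ := by
  refine Lp.ext ?_
  filter_upwards [coeFn_cpt (vecCls φ hφ e) a,
    Lp.coeFn_smul ((e : EuclideanSpace ℂ (Idx n k j)) a) (cls φ hφ),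
    ((ContinuousLinearMap.id ℂ ℂ).smulRight e).coeFn_compLp (cls φ hφ)] with p h1 h2 h3
  rw [h1, h2, comp, vecCls, h3]
  simp [mul_comm]

theorem cpt_sum {ι : Type*} (s : Finset ι) (f : ι → L2 n k j) (a : Idx n k j) :
    cpt (∑ i ∈ s, f i) a = ∑ i ∈ s, cpt (f i) a := by
  have h : ∀ f : L2 n k j, cpt f a = (coordV a).compLpL 2 (quotMeasure n) f := fun f => rfl
  simp only [h, map_sum]

end components

end TangentialCF

namespace TangentialCF
open Filter Topology ComplexConjugate

variable {n K : ℕ}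

/-! ### The operators `𝒟₀` and `𝒟₁` in components -/

/-- The component index of a `𝒱₀`-valued function. -/
def idx₀ (Q : Fin (K + 2) → Fin 2) : Idx n (K + 2) 0 := (Fin.elim0, Q)

/-- The component index of a `𝒱₁`-valued function. -/
def idx₁ (i : Idx₁ n K) : Idx n (K + 2) 1 := (fun _ => i.1, i.2)

/-- The component index of a `𝒱₂`-valued function. -/
def idx₂ (A A₂ : Fin n × Fin 2) (P : Fin K → Fin 2) : Idx n (K + 2) 2 := (![A, A₂], P)

theorem sum_idx₀ {M : Type*} [AddCommMonoid M] (G : Idx n (K + 2) 0 → M) :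
    ∑ a, G a = ∑ Q, G (idx₀ Q) := by
  rw [Fintype.sum_prod_type, Fintype.sum_unique]
  exact Finset.sum_congr rfl fun Q _ => congrArg G (Prod.ext (Subsingleton.elim _ _) rfl)

theorem sum_idx₁ {M : Type*} [AddCommMonoid M] (G : Idx n (K + 2) 1 → M) :
    ∑ a, G a = ∑ i, G (idx₁ i) :=
  (Fintype.sum_equiv (Equiv.prodCongr (Equiv.funUnique (Fin 1) (Fin n × Fin 2)).symm
    (Equiv.refl _)) _ _ fun _ => rfl).symm

theorem sum_idx₂ {M : Type*} [AddCommMonoid M] (G : Idx n (K + 2) 2 → M) :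
    ∑ a, G a = ∑ A, ∑ A₂, ∑ P, G (idx₂ A A₂ P) := by
  rw [Fintype.sum_prod_type, ← Fintype.sum_prod_type' fun A A₂ => ∑ P, G (idx₂ A A₂ P)]
  exact (Fintype.sum_equiv (finTwoArrowEquiv (Fin n × Fin 2)).symm _ _ fun _ => rfl).symm

theorem consPrimed_eq_cons {k : ℕ} (A' : Fin 2) (P : Fin k → Fin 2) {j : ℕ}
    (h : k + j + 1 - j = k + 1) (h' : k + j + 1 - (j + 1) = k) (i : Fin (k + j + 1 - j)) :
    consPrimed (k := k + j + 1) (j := j) A' (P ∘ Fin.cast h') i =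
      (Fin.cons A' P : Fin (k + 1) → Fin 2) (Fin.cast h i) := by
  obtain ⟨i, hi⟩ := i
  cases i with
  | zero => simp [consPrimed, Fin.cast]
  | succ i => simp [consPrimed, Fin.cast]; rfl

theorem sum_perm_fin_two {M : Type*} [AddCommMonoid M] (G : Equiv.Perm (Fin 2) → M) :
    ∑ σ, G σ = G 1 + G (Equiv.swap 0 1) := by
  have h : (Finset.univ : Finset (Equiv.Perm (Fin 2))) = {1, Equiv.swap 0 1} := by decide
  rw [h, Finset.sum_pair (by decide)]

theorem distD_one (f : L2 n (K + 2) 1) (A A₂ : Fin n × Fin 2) (P : Fin K → Fin 2)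
    (φ : Heis n → ℂ) :
    distD f (idx₂ A A₂ P) φ =
      ∑ A' : Fin 2, distZ A A' (comp f (idx₁ (A₂, Fin.cons A' P))) φ -
      ∑ A' : Fin 2, distZ A₂ A' (comp f (idx₁ (A, Fin.cons A' P))) φ := by
  have h : ∀ A' : Fin 2, consPrimed (k := K + 2) (j := 1) A' P =
      (Fin.cons A' P : Fin (K + 1) → Fin 2) := fun A' =>
    funext fun i => consPrimed_eq_cons (j := 1) A' P rfl rfl i
  have e0 : (fun i : Fin 1 => (![A, A₂] : Fin 2 → Fin n × Fin 2)
      ((1 : Equiv.Perm (Fin 2)) i.succ)) = fun _ => A₂ := by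
    funext i; fin_cases i; rfl
  have e1 : (fun i : Fin 1 => (![A, A₂] : Fin 2 → Fin n × Fin 2)
      ((Equiv.swap 0 1 : Equiv.Perm (Fin 2)) i.succ)) = fun _ => A := by
    funext i; fin_cases i; rfl
  rw [distD]
  simp only [Nat.reduceAdd]
  rw [sum_perm_fin_two]
  simp only [idx₂, idx₁, h, e0, e1]
  simp
  ring

theorem distD_zero (f : L2 n (K + 2) 0) (i : Idx₁ n K) (φ : Heis n → ℂ) :
    distD f (idx₁ i) φ = ∑ A' : Fin 2, distZ i.1 A' (comp f (idx₀ (Fin.cons A' i.2))) φ := by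
  have h : ∀ A' : Fin 2, consPrimed (k := K + 2) (j := 0) A' i.2 =
      (Fin.cons A' i.2 : Fin (K + 2) → Fin 2) := fun A' =>
    funext fun x => consPrimed_eq_cons (k := K + 1) (j := 0) A' i.2 rfl rfl x
  rw [distD]
  simp only [Nat.reduceAdd]
  rw [Fintype.sum_unique]
  simp only [idx₁, h, idx₀]
  have e : ∀ G : Fin 0 → Fin n × Fin 2, G = Fin.elim0 := fun G => Subsingleton.elim _ _
  simp [e]

/-- The relation `𝒟₁ f = v`, tested. -/
theorem weakD_one_relation {f : L2 n (K + 2) 1} {v : L2 n (K + 2) 2} (h : IsWeakD f v)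
    (A A₂ : Fin n × Fin 2) (P : Fin K → Fin 2) (φ : Heis n → ℂ) (hφ : IsTest φ) :
    ∑ z : (Fin 2 × Fin 4) ⊕ (Fin 2 × Fin 4),
      (Sum.elim (fun z => zeta A.2 z.1 z.2) (fun z => -zeta A₂.2 z.1 z.2) z) * inner ℂ
      (cls _ (isTest_DL hφ (Sum.elim (fun z => hor (A.1, z.2)) (fun z => hor (A₂.1, z.2))
        z)).continuous)
      (Sum.elim (fun z => cpt f (idx₁ (A₂, Fin.cons z.1 P)))
        (fun z => cpt f (idx₁ (A, Fin.cons z.1 P))) z) =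
      -inner ℂ (cls φ hφ.continuous) (cpt v (idx₂ A A₂ P)) := by
  have h1 := h _ hφ.conj (idx₂ A A₂ P)
  rw [integral_comp_mul_eq v _ hφ.conj.continuous, distD_one] at h1
  simp only [distZ_comp _ _ _ _ hφ.conj, Complex.conj_conj] at h1
  rw [h1, Fintype.sum_sum_type]
  simp only [Sum.elim_inl, Sum.elim_inr, Fintype.sum_prod_type, neg_mul, Finset.sum_neg_distrib]
  ring

theorem integral_pairing_DL {φ χ : Heis n → ℂ} (hφ : IsTest φ) (hχ : IsTest χ) (ξ : Heis n) :
    inner ℂ (cls _ (isTest_DL hχ.conj ξ).continuous) (cls φ hφ.continuous) =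
      -inner ℂ (cls _ hχ.conj.continuous) (cls _ (isTest_DL hφ ξ).continuous) := by
  have e : ∀ {a b : Heis n → ℂ} (ha : Continuous a) (hb : Continuous b),
      inner ℂ (cls a ha) (cls b hb) = ∫ p, conj (a p) * b p ∂quotMeasure n := by
    intro a b ha hb
    rw [inner_cls]
    refine integral_congr_ae ?_
    filter_upwards [coeFn_cls hb] with p hp
    rw [hp]
  rw [e, e]
  simp only [DL_conj hχ, Complex.conj_conj]
  exact integral_DL_mul hχ hφ ξ

/-- The coefficient of `Y_a φ` in `𝒟₀ (φ e)`. -/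
noncomputable def coeffV (e : V n (K + 2) 0) (a : Fin n × Fin 4) : V n (K + 2) 1 :=
  ⟨WithLp.toLp 2 fun x => if (x.1 0).1 = a.1 then ∑ A' : Fin 2, zeta (x.1 0).2 A' a.2 *
      (e : EuclideanSpace ℂ (Idx n (K + 2) 0)) (idx₀ (Fin.cons A' x.2)) else 0, by
    intro σ ρ A P
    have hσ : σ = 1 := Subsingleton.elim _ _
    subst hσ
    have h : ∀ A' : Fin 2, (e : EuclideanSpace ℂ (Idx n (K + 2) 0))
        (idx₀ (Fin.cons A' (P ∘ ρ) : Fin (K + 2) → Fin 2)) =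
        (e : EuclideanSpace ℂ (Idx n (K + 2) 0)) (idx₀ (Fin.cons A' P : Fin (K + 2) → Fin 2)) := by
      intro A'
      have h1 := e.2 1 (Equiv.Perm.decomposeFin.symm (0, ρ)) Fin.elim0
        (Fin.cons A' P : Fin (K + 2) → Fin 2)
      have h2 : (Fin.cons A' (P ∘ ρ) : Fin (K + 2) → Fin 2) =
          (Fin.cons A' P : Fin (K + 2) → Fin 2) ∘ Equiv.Perm.decomposeFin.symm (0, ρ) := by
        funext x
        refine Fin.cases ?_ (fun x => ?_) x
        · simp
        · simp [Equiv.Perm.decomposeFin_symm_apply_succ]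
      rw [h2]
      simpa [idx₀] using h1
    simp only [Function.comp_apply, Equiv.Perm.coe_one, id_eq, Equiv.Perm.sign_one]
    have h' := h
    simp only [h]
    simp⟩

theorem coeffV_apply (e : V n (K + 2) 0) (a : Fin n × Fin 4) (i : Idx₁ n K) :
    (coeffV e a : EuclideanSpace ℂ (Idx n (K + 2) 1)) (idx₁ i) =
      if i.1.1 = a.1 then ∑ A' : Fin 2, zeta i.1.2 A' a.2 *
      (e : EuclideanSpace ℂ (Idx n (K + 2) 0)) (idx₀ (Fin.cons A' i.2)) else 0 := rfl

theorem exists_eq_idx₁ (a : Idx n (K + 2) 1) : ∃ i, a = idx₁ i :=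
  ⟨(a.1 0, a.2), Prod.ext (funext fun x => by rw [Subsingleton.elim x 0]; rfl) rfl⟩

/-- `𝒟₀` on products of test functions and constant vectors. -/
theorem isWeakD_vecCls {φ : Heis n → ℂ} (hφ : IsTest φ) (e : V n (K + 2) 0) :
    IsWeakD (vecCls φ hφ.continuous e)
      (∑ a, vecCls _ (isTest_DL hφ (hor a)).continuous (coeffV e a)) := by
  intro χ hχ x
  obtain ⟨i, rfl⟩ := exists_eq_idx₁ x
  rw [integral_comp_mul_eq _ _ hχ.continuous, distD_zero, cpt_sum]
  simp only [distZ_comp _ _ _ _ hχ, cpt_vecCls, inner_smul_right, inner_sum, coeffV_apply,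
    integral_pairing_DL hφ hχ]
  rw [Fintype.sum_prod_type]
  simp only [ite_mul, zero_mul, Finset.sum_ite_irrel, Finset.sum_const_zero, Finset.sum_ite_eq,
    Finset.mem_univ, if_true, Finset.sum_mul]
  rw [Finset.sum_comm]
  refine Finset.sum_congr rfl fun A' _ => ?_
  rw [← Finset.sum_neg_distrib]
  exact Finset.sum_congr rfl fun q _ => by ring

/-- The symmetrization of a basis vector. -/
noncomputable def symmVec (Q : Fin (K + 2) → Fin 2) : V n (K + 2) 0 :=
  ⟨WithLp.toLp 2 fun x => ((K + 2).factorial : ℂ)⁻¹ *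
      ∑ σ : Equiv.Perm (Fin (K + 2)), if Q ∘ σ = x.2 then 1 else 0, by
    intro σ ρ A P
    have hσ : σ = 1 := Subsingleton.elim _ _
    subst hσ
    simp only [Equiv.Perm.sign_one, Units.val_one, Int.cast_one, one_mul]
    congr 1
    refine Fintype.sum_equiv (Equiv.mulRight ρ⁻¹) _ _ fun σ => ?_
    refine if_congr ⟨fun h => ?_, fun h => ?_⟩ rfl rfl
    · funext x
      have := congrFun h (ρ⁻¹ x)
      simpa using this
    · funext x
      have := congrFun h (ρ x)
      simpa using this⟩

theorem symmVec_apply (Q R : Fin (K + 2) → Fin 2) :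
    (symmVec Q : V n (K + 2) 0).1 (idx₀ R) = ((K + 2).factorial : ℂ)⁻¹ *
      ∑ σ : Equiv.Perm (Fin (K + 2)), if Q ∘ σ = R then 1 else 0 := rfl

theorem conj_symmVec_apply (Q R : Fin (K + 2) → Fin 2) :
    conj ((symmVec Q : V n (K + 2) 0).1 (idx₀ R)) = (symmVec Q : V n (K + 2) 0).1 (idx₀ R) := by
  rw [symmVec_apply]
  simp only [map_mul, map_inv₀, Complex.conj_natCast, map_sum]
  congr 1
  exact Finset.sum_congr rfl fun σ _ => by split_ifs <;> simp

theorem sum_symmVec_smul {H : Type*} [NormedAddCommGroup H] [InnerProductSpace ℂ H]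
    (Q : Fin (K + 2) → Fin 2) (W : (Fin (K + 2) → Fin 2) → H) :
    ∑ R, (symmVec Q : V n (K + 2) 0).1 (idx₀ R) • W R = symmetrize W Q := by
  simp only [symmVec_apply, mul_smul, ← Finset.smul_sum, symmetrize, Finset.sum_smul]
  congr 1
  rw [Finset.sum_comm]
  simp

theorem symmetrize_cpt (u : L2 n (K + 2) 0) (Q : Fin (K + 2) → Fin 2) :
    symmetrize (fun R => cpt u (idx₀ R)) Q = cpt u (idx₀ Q) := by
  have h : ∀ σ : Equiv.Perm (Fin (K + 2)), cpt u (idx₀ (Q ∘ σ)) = cpt u (idx₀ Q) := by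
    intro σ
    have := cpt_perm u 1 σ Fin.elim0 Q
    simpa [idx₀] using this
  have hm : ((K + 2).factorial : ℂ) ≠ 0 := Nat.cast_ne_zero.2 (Nat.factorial_ne_zero _)
  simp only [symmetrize, h, Finset.sum_const, Finset.card_univ, Fintype.card_perm,
    Fintype.card_fin]
  rw [← Nat.cast_smul_eq_nsmul ℂ, smul_smul, inv_mul_cancel₀ hm, one_smul]

/-- The relation `𝒟₀^* f = u`, tested. -/
theorem dStar_relation {f : L2 n (K + 2) 1} {u : L2 n (K + 2) 0}
    (h : (f, u) ∈ graphDStar n (K + 2) 0) (Q : Fin (K + 2) → Fin 2) (φ : Heis n → ℂ)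
    (hφ : IsTest φ) :
    ∑ z : (Fin n × Fin 4) × Idx₁ n K, (-conj ((coeffV (symmVec Q) z.1).1 (idx₁ z.2))) *
      inner ℂ (cls _ (isTest_DL hφ (hor z.1)).continuous) (cpt f (idx₁ z.2)) =
      -inner ℂ (cls φ hφ.continuous) (cpt u (idx₀ Q)) := by
  -- The product of a test function with a constant vector lies in the maximal domain of 𝒟₀. Taking
  -- the symmetrized basis vector isolates the component of u at Q.
  have hmem : ((vecCls φ hφ.continuous (symmVec Q) : L2 n (K + 2) 0),
      (∑ a, vecCls _ (isTest_DL hφ (hor a)).continuous (coeffV (symmVec Q) a) :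
        L2 n (K + 2) (0 + 1))) ∈ graphD n (K + 2) 0 := isWeakD_vecCls hφ (symmVec Q)
  have h1 : inner ℂ (∑ a, vecCls _ (isTest_DL hφ (hor a)).continuous (coeffV (symmVec Q) a) :
        L2 n (K + 2) 1) f - inner ℂ (vecCls φ hφ.continuous (symmVec Q)) u = 0 :=
    (Submodule.mem_adjoint_iff _ _).1 h _ _ hmem
  rw [sub_eq_zero] at h1
  rw [inner_eq_sum_cpt, inner_eq_sum_cpt, sum_idx₁, sum_idx₀] at h1
  simp only [cpt_sum, sum_inner, cpt_vecCls, inner_smul_left] at h1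
  rw [Finset.sum_comm] at h1
  have h2 : ∑ R, conj ((symmVec Q : V n (K + 2) 0).1 (idx₀ R)) *
      inner ℂ (cls φ hφ.continuous) (cpt u (idx₀ R)) =
      inner ℂ (cls φ hφ.continuous) (cpt u (idx₀ Q)) := by
    simp only [conj_symmVec_apply, ← inner_smul_right, ← inner_sum]
    rw [sum_symmVec_smul, symmetrize_cpt]
  rw [h2] at h1
  rw [Fintype.sum_prod_type, ← h1]
  simp only [neg_mul, Finset.sum_neg_distrib]

/-- The formal adjoint of `𝒟₀` in terms of the horizontal derivatives. -/
theorem sum_coeffV_smul (Q : Fin (K + 2) → Fin 2) (y : Idx₁ n K → Fin n × Fin 4 → SL2 n) :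
    ∑ z : (Fin n × Fin 4) × Idx₁ n K, (-conj ((coeffV (symmVec Q) z.1).1 (idx₁ z.2))) •
      y z.2 z.1 = symmetrize (wComb y) Q := by
  have e : ∀ z : (Fin n × Fin 4) × Idx₁ n K, conj ((coeffV (symmVec Q) z.1).1 (idx₁ z.2)) =
      if z.2.1.1 = z.1.1 then ∑ A' : Fin 2, conj (zeta z.2.1.2 A' z.1.2) *
        (symmVec Q : V n (K + 2) 0).1 (idx₀ (Fin.cons A' z.2.2)) else 0 := by
    intro z
    rw [coeffV_apply]
    split_ifs
    · simp only [map_sum, map_mul]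
      exact Finset.sum_congr rfl fun A' _ => by rw [conj_symmVec_apply]
    · simp
  rw [← sum_symmVec_smul (n := n), sum_cons]
  simp only [e, wComb, Fin.cons_zero, Fin.tail_cons, zAdj]
  rw [Fintype.sum_prod_type_right, Fintype.sum_prod_type_right]
  refine Finset.sum_congr rfl fun R _ => ?_
  simp only [Finset.smul_sum, smul_neg, Finset.sum_neg_distrib, neg_smul]
  rw [Finset.sum_comm (s := (Finset.univ : Finset (Fin 2)))]
  congr 1
  refine Finset.sum_congr rfl fun A _ => ?_
  rw [Fintype.sum_prod_type]
  simp only [ite_smul, zero_smul, Finset.sum_ite_irrel, Finset.sum_const_zero, Finset.sum_ite_eq,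
    Finset.mem_univ, if_true, Finset.sum_smul]
  rw [Finset.sum_comm]
  refine Finset.sum_congr rfl fun A' _ => Finset.sum_congr rfl fun q _ => ?_
  rw [smul_smul, mul_comm]

theorem sum_zeta_smul (A A₂ : Fin n × Fin 2) (P : Fin K → Fin 2) {ψ : Heis n → ℝ}
    (F : Idx₁ n K → SL2 n) :
    ∑ z : (Fin 2 × Fin 4) ⊕ (Fin 2 × Fin 4),
      (Sum.elim (fun z => zeta A.2 z.1 z.2) (fun z => -zeta A₂.2 z.1 z.2) z) •
      moll (DR (Sum.elim (fun z => hor (A.1, z.2)) (fun z => hor (A₂.1, z.2)) z) ψ)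
      (Sum.elim (fun z => F (A₂, Fin.cons z.1 P)) (fun z => F (A, Fin.cons z.1 P)) z) =
    xComb (fun i a => moll (DR (hor a) ψ) (F i)) A A₂ P -
      xComb (fun i a => moll (DR (hor a) ψ) (F i)) A₂ A P := by
  rw [Fintype.sum_sum_type]
  simp only [Sum.elim_inl, Sum.elim_inr, Fintype.sum_prod_type, neg_smul, Finset.sum_neg_distrib,
    xComb, zComb, sub_eq_add_neg]

/-! ### The estimate -/

/-- The estimate for smooth functions. -/
theorem sum_norm_sq_moll_le (hn : 3 < n) {ψ : Heis n → ℝ} (hψ : IsBump ψ) {F : Idx₁ n K → SL2 n}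
    (hF : ∀ A R (σ : Equiv.Perm (Fin (K + 1))), F (A, R ∘ σ) = F (A, R))
    (h0 : ∀ i, ∫ p, F i p ∂quotMeasure n = 0) :
    2 * (1 - 3 / n) * ∑ i, ‖moll ψ (F i)‖ ^ 2 ≤
      676 * n * (∑ A, ∑ A₂, ∑ P, ‖xComb (fun i a => moll (DR (hor a) ψ) (F i)) A A₂ P -
          xComb (fun i a => moll (DR (hor a) ψ) (F i)) A₂ A P‖ ^ 2 +
        2 * ∑ Q, ‖symmetrize (wComb fun i a => moll (DR (hor a) ψ) (F i)) Q‖ ^ 2) := by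
  have hn0 : 0 < n := by omega
  have hpos : (0 : ℝ) ≤ 2 * (1 - 3 / n) := by
    have h3 : (3 : ℝ) / n ≤ 1 := by
      rw [div_le_one (by positivity)]
      exact_mod_cast hn.le
    linarith
  have h1 : ∑ i, ‖moll ψ (F i)‖ ^ 2 ≤ 676 * n * ∑ i, ∑ a, ‖moll (DR (hor a) ψ) (F i)‖ ^ 2 := by
    rw [Finset.mul_sum]
    refine Finset.sum_le_sum fun i _ => ?_
    have hG := hasGen_gen hψ (F i)
    have hI := integral_moll_eq_zero hψ (h0 i)
    have := norm_sq_le_of_integral_eq_zero hn0 hG hI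
    simp only [gen_apply] at this
    exact this
  have h2 := (heisRel_gen hψ F).weitzenboeck hn0 fun A R σ => by
    simp only [hF]
  simp only [gen_apply] at h2
  have h3 := mul_le_mul_of_nonneg_left h1 hpos
  have h4 := mul_le_mul_of_nonneg_left h2 (show (0 : ℝ) ≤ 676 * n by positivity)
  refine h3.trans (le_trans (le_of_eq ?_) h4)
  ring

/-- The estimate holds for mollifications of f. As the mollifier shrinks, its left side tends to
that of f, while the expressions for 𝒟₁ and 𝒟₀^* converge to the components of v and u. -/
theorem norm_sq_le_of_mem_graph (hn : 3 < n) {f : L2 n (K + 2) 1} {u : L2 n (K + 2) 0}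
    {v : L2 n (K + 2) 2} (hu : (f, u) ∈ graphDStar n (K + 2) 0) (hv : (f, v) ∈ graphD n (K + 2) 1)
    (hf : OrthConst f) :
    2 * (1 - 3 / n) * ‖f‖ ^ 2 ≤ 676 * n * (‖v‖ ^ 2 + 2 * ‖u‖ ^ 2) := by
  obtain ⟨χ, hχ, hχ1⟩ := exists_isBump_integral_eq_one (n := n)
  let F : Idx₁ n K → SL2 n := fun i => cpt f (idx₁ i)
  have hF : ∀ A R (σ : Equiv.Perm (Fin (K + 1))), F (A, R ∘ σ) = F (A, R) := by
    intro A R σ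
    have := cpt_perm f 1 σ (fun _ => A) R
    simpa [F, idx₁] using this
  have lim_f : ∀ i, Tendsto (fun ε => moll (dil ε χ) (F i)) (𝓝[>] 0) (𝓝 (F i)) := fun i => by
    simpa [hχ1] using tendsto_moll_dil hχ (F i)
  have lim_v : ∀ A A₂ P, Tendsto (fun ε =>
      xComb (fun i a => moll (DR (hor a) (dil ε χ)) (F i)) A A₂ P -
        xComb (fun i a => moll (DR (hor a) (dil ε χ)) (F i)) A₂ A P) (𝓝[>] 0)
      (𝓝 (cpt v (idx₂ A A₂ P))) := fun A A₂ P => by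
    have := tendsto_sum_smul_moll _ _ _ _ _ (weakD_one_relation hv A A₂ P) hχ hχ1
    exact this.congr fun ε => sum_zeta_smul A A₂ P F
  have lim_u : ∀ Q, Tendsto (fun ε =>
      symmetrize (wComb fun i a => moll (DR (hor a) (dil ε χ)) (F i)) Q) (𝓝[>] 0)
      (𝓝 (cpt u (idx₀ Q))) := fun Q => by
    have := tendsto_sum_smul_moll _ _ _ _ _ (dStar_relation hu Q) hχ hχ1
    exact this.congr fun ε => sum_coeffV_smul Q fun i a => moll (DR (hor a) (dil ε χ)) (F i)
  have L1 := (tendsto_finsetSum Finset.univ fun i _ => ((lim_f i).norm.pow 2)).const_mul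
    (2 * (1 - 3 / (n : ℝ)))
  have L2' := ((tendsto_finsetSum Finset.univ fun A _ => tendsto_finsetSum Finset.univ fun A₂ _ =>
    tendsto_finsetSum Finset.univ fun P _ => (lim_v A A₂ P).norm.pow 2).add
    ((tendsto_finsetSum Finset.univ fun Q _ => (lim_u Q).norm.pow 2).const_mul 2)).const_mul
    (676 * (n : ℝ))
  rw [norm_sq_eq_sum_cpt f, norm_sq_eq_sum_cpt v, norm_sq_eq_sum_cpt u, sum_idx₁, sum_idx₂,
    sum_idx₀]
  refine le_of_tendsto_of_tendsto L1 L2' ?_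
  filter_upwards [self_mem_nhdsWithin] with ε hε
  exact sum_norm_sq_moll_le hn (hχ.dil hε) hF fun i => integral_cpt_eq_zero hf _

end TangentialCF

/-! ### The theorem -/

theorem mainTheorem4 (n k : ℕ) (hn : 3 < n) (hk : 2 ≤ k) :
    ∃ c : ℝ, 0 < c ∧
      ∀ (f : L2 n k 1) (u : L2 n k 0) (v : L2 n k 2),
        (f, u) ∈ graphDStar n k 0 → (f, v) ∈ graphD n k 1 → OrthConst f →
        ‖u‖ ^ 2 + ‖v‖ ^ 2 ≥ c * ‖f‖ ^ 2 := by
  obtain ⟨K, rfl⟩ := Nat.exists_eq_add_of_le' hk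
  have hn3 : (3 : ℝ) < n := by exact_mod_cast hn
  have h3 : (0 : ℝ) < 1 - 3 / n := by
    rw [sub_pos, div_lt_one (by linarith)]
    exact hn3
  -- The factor 2 on the left of the preceding estimate is cancelled by bounding ‖v‖² + 2‖u‖² by
  -- 2(‖u‖² + ‖v‖²).
  refine ⟨(1 - 3 / n) / (676 * n), by positivity, fun f u v hu hv hf => ?_⟩
  have h := norm_sq_le_of_mem_graph hn hu hv hf
  have hp : (0 : ℝ) < 676 * n := by linarith
  rw [ge_iff_le, div_mul_eq_mul_div, div_le_iff₀ hp]
  nlinarith [sq_nonneg ‖u‖, sq_nonneg ‖v‖, mul_nonneg hp.le (sq_nonneg ‖v‖)]
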